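/- Let $k\ge 1$ be an integer and let $s_0\in(0,2^{-1+1/k})$. Throughout, $(X,d)$ is a countable metric space and $\pi$ a positive measure on $X$ (that is, $0<\pi(x)<\infty$ for every $x\in X$, where $\pi(x)=\pi(\{x\})$); $B(x,t)=\{y: d(x,y)\le t\}$ and $V(x,t)=\pi(B(x,t))$. A bounded operator $M$ on $\ell^2(X,\pi)$ is identified with its matrix $M(x,y)=(M\delta_y)(x)$, so that $Mf(x)=\sum_y M(x,y)f(y)$. Put $M_k=I-(I-M)^k$. We call $M$ admissible if it is a hermitian contraction of $\ell^2(X,\pi)$ with $M(x,y)=0$ whenever $d(x,y)>1$, with $\sum_y M(x,y)=1$ for every $x$, and with spectrum contained in $(1-2s_0,1]$. For admissible $M$ the numbers $M_k^{2n}(x,x)$ are real. **Theorem.** There are constants $C,c\in(0,\infty)$, depending only on $k$ and $s_0$, such that the following holds for all $(X,d)$, $\pi$, all admissible $M$ and all $x\in X$. Let $v:[0,\infty)\to(0,\infty)$ be an increasing (i.e. non-decreasing) function with $$V(x,2t)\le \pi(x)\,v(t)\quad(t\ge 0),\qquad v(0)\ge (1+2C)^{1/2},$$ and such that $t\mapsto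 t^{\frac{2k}{2k-1}}/\log v(t)$ is increasing (i.e. non-decreasing) on $[0,\infty)$ and tends to infinity. Then for every $n\in\{0,1,2,\dots\}$ there is a smallest integer $r=r(n)\ge 0$ with $$5\,n^{1/(2k-1)}\le c\,\frac{r^{\frac{2k}{2k-1}}}{\log v(r)},$$ and $$M_k^{2n}(x,x)\ \ge\ \frac14\,\frac{\pi(x)}{V(x,r(n))}.$$ In particular: 1. For all real $A,D$ there is $a>0$, depending only on $k,s_0,A,D$, such that for all $(X,d)$, $\pi$, admissible $M$ and $x\in X$: if $V(x,t)\le A\,\pi(x)(1+t)^D$ for all $t\ge 0$, then for all $n\ge 1$ $$M_k^{2n}(x,x)\ \ge\ a\,\bigl[(1+n)\,(\log(1+n))^{2k-1}\bigr]^{-D/(2k)}.$$ 2. For all real $A$ and all $\beta\in\bigl(0,\frac{2k}{2k-1}\bigr)$ there is $A_0>0$, depending only on $k,s_0,A,\beta$, such that for all $(X,d)$, $\pi$, admissible $M$ and $x\in X$: if $V(x,t)\le \pi(x)\exp(At^\beta)$ for all $t\ge 0$, then for all $n\ge 0$ $$M_k^{2n}(x,x)\ \ge\ \exp\Bigl(-A_0\,n^{\frac{\beta(2k-1)}{2k(1-\beta)+\beta}}\Bigr).$$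 -/

import Mathlib

open MeasureTheory Set Filter
open scoped ENNReal ComplexOrder

universe u

/-- A positive measure on a countable set, seen as a function `x ↦ π {x}` with values in `(0, ∞)`. -/
class IsPositiveOnPoints {X : Type*} [MeasurableSpace X] (π : Measure X) : Prop where
  pos : ∀ x : X, 0 < π {x}
  lt_top : ∀ x : X, π {x} < ∞

section

variable {X : Type*} [MeasurableSpace X] [MeasurableSingletonClass X]

/-- The indicator function `δ_y` of the point `y`, as an element of `ℓ²(X, π)`. -/
noncomputable def delta (π : Measure X) [IsPositiveOnPoints π] (y : X) : Lp ℂ 2 π :=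
  indicatorConstLp 2 (measurableSet_singleton y) (IsPositiveOnPoints.lt_top y).ne (1 : ℂ)

/-- The matrix entry `T(x, y) = (T δ_y)(x)` of a bounded operator `T` on `ℓ²(X, π)`, so that
`T f (x) = ∑_y T(x, y) f(y)`; see `hasSum_entry`. -/
noncomputable def entry {π : Measure X} [IsPositiveOnPoints π]
    (T : Lp ℂ 2 π →L[ℂ] Lp ℂ 2 π) (x y : X) : ℂ :=
  T (delta π y) x

end

/-- `M_k = I - (I - M)^k`. -/
noncomputable def powLaplace {X : Type*} [MeasurableSpace X] {π : Measure X} (k : ℕ)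
    (M : Lp ℂ 2 π →L[ℂ] Lp ℂ 2 π) : Lp ℂ 2 π →L[ℂ] Lp ℂ 2 π :=
  1 - (1 - M) ^ k

/-- `M` is a hermitian contraction of `ℓ²(X, π)`, of range one for the metric of `X`, with all row
sums equal to `1` and with spectrum contained in `(1 - 2 s₀, 1]`. -/
structure IsStochasticHermitianContraction {X : Type*} [MetricSpace X] [MeasurableSpace X]
    [MeasurableSingletonClass X] {π : Measure X} [IsPositiveOnPoints π] (s₀ : ℝ)
    (M : Lp ℂ 2 π →L[ℂ] Lp ℂ 2 π) : Prop where
  hermitian : IsSelfAdjoint M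
  contraction : ‖M‖ ≤ 1
  finite_range : ∀ x y : X, 1 < dist x y → entry M x y = 0
  row_sum : ∀ x : X, HasSum (fun y => entry M x y) 1
  spectrum_subset : spectrum ℂ M ⊆ (fun t : ℝ => (t : ℂ)) '' Ioc (1 - 2 * s₀) 1

section

variable {X : Type*} [MeasurableSpace X] [MeasurableSingletonClass X]

/-- The value of `f` at `x` through the inner product. -/
theorem apply_eq_inner {π : Measure X} [IsPositiveOnPoints π] (f : Lp ℂ 2 π) (x : X) :
    inner ℂ (delta π x) f = (π.real {x} : ℂ) * f x := by
  rw [delta, L2.inner_indicatorConstLp_one, integral_singleton]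
  simp

/-- The inner product of `ℓ²(X, π)` as a sum. -/
theorem hasSum_inner [Countable X] {π : Measure X} [IsPositiveOnPoints π] (f g : Lp ℂ 2 π) :
    HasSum (fun y => (π.real {y} : ℂ) * inner ℂ (g y) (f y)) (inner ℂ g f) := by
  have hi := L2.integrable_inner (𝕜 := ℂ) g f
  have h := hasSum_integral_iUnion (μ := π) (f := fun a => inner ℂ (g a) (f a))
    (s := fun y : X => {y}) (fun y => measurableSet_singleton y)
    (fun a b hab => by simpa [Function.onFun] using hab) hi.integrableOn
  simp only [integral_singleton, iUnion_of_singleton, setIntegral_univ] at h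
  simpa [L2.inner_def] using h

/-- The action of an operator is given by its matrix. -/
theorem hasSum_entry [Countable X] {π : Measure X} [IsPositiveOnPoints π]
    (T : Lp ℂ 2 π →L[ℂ] Lp ℂ 2 π) (f : Lp ℂ 2 π) (x : X) :
    HasSum (fun y => entry T x y * f y) (T f x) := by
  have hne : ∀ z : X, (π.real {z} : ℂ) ≠ 0 := fun z => by
    exact_mod_cast (ENNReal.toReal_pos (IsPositiveOnPoints.pos z).ne'
      (IsPositiveOnPoints.lt_top z).ne).ne'
  have key : ∀ h : Lp ℂ 2 π, T h x =
      inner ℂ (ContinuousLinearMap.adjoint T (delta π x)) h / (π.real {x} : ℂ) := fun h => by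
    rw [ContinuousLinearMap.adjoint_inner_left, apply_eq_inner, mul_div_cancel_left₀ _ (hne x)]
  rw [key f]
  have hs := (hasSum_inner f (ContinuousLinearMap.adjoint T (delta π x))).div_const
    (π.real {x} : ℂ)
  have he : ∀ y, entry T x y * f y = (π.real {y} : ℂ) *
      inner ℂ (ContinuousLinearMap.adjoint T (delta π x) y) (f y) / (π.real {x} : ℂ) := fun y => by
    rw [show entry T x y = T (delta π y) x from rfl, key (delta π y), ← inner_conj_symm,
      apply_eq_inner, RCLike.inner_apply]
    simp only [map_mul, Complex.conj_ofReal]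
    ring
  simpa only [he] using hs

end

/-! The argument is of Carne–Varopoulos type. Put `L = 2 s₀` and `w = 1 - (2/L)(1 - M)`, whose
spectrum lies in `[-1, 1]`. Expand the polynomial representing `M_k ^ n` as `∑ a_j T_j(w)`. Each
`T_j(w)` is a contraction, and having degree `j` in `M` it moves mass by a distance at most `j`. So
at distance more than `R` from `x` only the `a_j` with `j > R` contribute to `M_k ^ n δ_x`.

With `w = cos θ` the symbol of `M_k` is `1 - (L sin² (θ/2)) ^ k`. The bound on `s₀` says exactly
that `L ^ k < 2`, so for real `θ` the symbol has modulus less than `1` away from the zeros of the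
sine, and at `θ = t - i b` its modulus is at most `exp (K b^(2k) - c t^(2k))`
(`exists_norm_symbol_le`). Shifting the Fourier integral for `a_j` by `b` gains `exp (-j b)` at the
price `exp (n K b^(2k))`. The choice `b ≈ (R/n)^(1/(2k-1))` balances the two and yields
`exists_sum_chebyshev_coeff_le`, the tail bound `C exp (-c R (R/n)^(1/(2k-1)))`.

The row sums and the symmetry of `M` give `M_k ^ n δ_x` total mass `π(x)`. Cauchy–Schwarz on dyadic
annuli, the tail bound and the volume growth show that at most half of it lies outside `B(x, r)`. A
second Cauchy–Schwarz inequality on `B(x, r)` bounds `‖M_k ^ n δ_x‖² = π(x) M_k^(2n)(x, x)` from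
below by `π(x)² / (4 V(x, r))` (`le_entry_of_concentration`). This works at every real radius
satisfying the scale condition (`exists_le_entry`), so the two growth corollaries only have to
exhibit a convenient radius. -/

/-! ### Chebyshev expansions of polynomials -/

/-- Every polynomial of degree at most `N` is a combination of `T_0, …, T_N`. -/
theorem exists_eq_sum_chebyshev (N : ℕ) : ∀ p : Polynomial ℂ, p.natDegree ≤ N →
    ∃ a : ℕ → ℂ, p = ∑ j ∈ Finset.range (N + 1),
      Polynomial.C (a j) * Polynomial.Chebyshev.T ℂ j := by
  induction N with
  | zero =>
    intro p hp
    refine ⟨fun _ => p.coeff 0, ?_⟩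
    simpa using Polynomial.eq_C_of_natDegree_le_zero hp
  | succ N ih =>
    intro p hp
    -- `T_{N+1}` has leading coefficient `2 ^ N`, so subtracting `c T_{N+1}` lowers the degree.
    set c : ℂ := p.coeff (N + 1) / 2 ^ N
    have hT : (Polynomial.Chebyshev.T ℂ ((N + 1 : ℕ) : ℤ)).natDegree = N + 1 := by
      rw [Polynomial.Chebyshev.natDegree_T, Int.natAbs_natCast]
    have hlc : (Polynomial.Chebyshev.T ℂ ((N + 1 : ℕ) : ℤ)).coeff (N + 1) = 2 ^ N := by
      have := Polynomial.Chebyshev.leadingCoeff_T ℂ ((N + 1 : ℕ) : ℤ)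
      rwa [Polynomial.leadingCoeff, hT, Int.natAbs_natCast, Nat.add_sub_cancel] at this
    have hdeg : (p - Polynomial.C c * Polynomial.Chebyshev.T ℂ ((N + 1 : ℕ) : ℤ)).natDegree ≤ N := by
      rw [Polynomial.natDegree_le_iff_coeff_eq_zero]
      intro m hm
      rw [Polynomial.coeff_sub, Polynomial.coeff_C_mul]
      rcases Nat.lt_or_ge (N + 1) m with h | h
      · rw [Polynomial.coeff_eq_zero_of_natDegree_lt (by omega),
          Polynomial.coeff_eq_zero_of_natDegree_lt (by omega)]
        simp
      · obtain rfl : m = N + 1 := by omega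
        rw [hlc]
        simp [c]
    obtain ⟨a, ha⟩ := ih _ hdeg
    refine ⟨fun j => if j = N + 1 then c else a j, ?_⟩
    simp only [Finset.sum_range_succ _ (N + 1), if_true]
    rw [← sub_eq_iff_eq_add, ha]
    refine Finset.sum_congr rfl fun j hj => ?_
    rw [if_neg (by have := Finset.mem_range.1 hj; omega)]

theorem integral_exp_int_mul_I (m : ℤ) :
    ∫ t in (-Real.pi)..Real.pi, Complex.exp ((m : ℂ) * Complex.I * t) =
      if m = 0 then 2 * (Real.pi : ℂ) else 0 := by
  split_ifs with h
  · subst h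
    simp
    ring
  · rw [integral_exp_mul_complex (by simp [h]),
      (Complex.exp_eq_exp_iff_exists_int
        (x := (m : ℂ) * Complex.I * (Real.pi : ℝ)) (y := (m : ℂ) * Complex.I * ((-Real.pi : ℝ) : ℂ))).2
        ⟨m, by push_cast; ring⟩]
    simp

/-- On the shifted line the frequency `m` is amplified by `exp (m b)` and the frequency `-m` is
damped. Since `j ≥ 1`, only the amplified one can be detected; this is the source of the decay `exp
(-j b)` of Chebyshev coefficients. -/
theorem integral_cos_mul_exp (m j : ℕ) (hj : 1 ≤ j) (b : ℝ) :
    ∫ t in (-Real.pi)..Real.pi,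
      Complex.cos (m * ((t : ℂ) - b * Complex.I)) * Complex.exp (-(j : ℂ) * Complex.I * t) =
      if m = j then Real.pi * Complex.exp (j * b) else 0 := by
  have h : ∀ t : ℝ, Complex.cos (m * ((t : ℂ) - b * Complex.I)) *
      Complex.exp (-(j : ℂ) * Complex.I * t) =
      Complex.exp (m * b) / 2 * Complex.exp ((((m : ℤ) - j : ℤ) : ℂ) * Complex.I * t) +
      Complex.exp (-(m * b)) / 2 * Complex.exp (((-(m : ℤ) - j : ℤ) : ℂ) * Complex.I * t) := by
    intro t
    rw [Complex.cos, div_mul_eq_mul_div, add_mul, ← Complex.exp_add, ← Complex.exp_add,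
      div_mul_eq_mul_div, div_mul_eq_mul_div, ← Complex.exp_add, ← Complex.exp_add, ← add_div]
    congr 3
    · push_cast
      linear_combination (norm := ring_nf) (-(m : ℂ) * b) * Complex.I_sq
    · push_cast
      linear_combination (norm := ring_nf) ((m : ℂ) * b) * Complex.I_sq
  simp_rw [h]
  rw [intervalIntegral.integral_add
    (Continuous.intervalIntegrable (by fun_prop) _ _)
    (Continuous.intervalIntegrable (by fun_prop) _ _),
    intervalIntegral.integral_const_mul, intervalIntegral.integral_const_mul,
    integral_exp_int_mul_I, integral_exp_int_mul_I, if_neg (by omega : ¬ (-(m : ℤ) - j = 0))]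
  by_cases hm : m = j
  · subst hm
    simp
    ring
  · rw [if_neg (by omega), if_neg hm]
    simp

/-- The coefficients of a Chebyshev expansion are controlled by the polynomial on the ellipse
`{cos (t - i b)}`. -/
theorem norm_chebyshev_coeff_le {N : ℕ} {p : Polynomial ℂ} {a : ℕ → ℂ}
    (hp : p = ∑ j ∈ Finset.range (N + 1), Polynomial.C (a j) * Polynomial.Chebyshev.T ℂ j)
    {j : ℕ} (hj : 1 ≤ j) (hjN : j ≤ N) (b : ℝ) :
    ‖a j‖ ≤ Real.exp (-(j * b)) *
      ∫ t in (-Real.pi)..Real.pi, ‖p.eval (Complex.cos ((t : ℂ) - b * Complex.I))‖ := by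
  have hev : ∀ w : ℂ, p.eval (Complex.cos w) =
      ∑ m ∈ Finset.range (N + 1), a m * Complex.cos (m * w) := by
    intro w
    rw [hp, Polynomial.eval_finsetSum]
    refine Finset.sum_congr rfl fun m _ => ?_
    rw [Polynomial.eval_mul, Polynomial.eval_C, Polynomial.Chebyshev.T_complex_cos]
    simp
  have hint : ∫ t in (-Real.pi)..Real.pi, p.eval (Complex.cos ((t : ℂ) - b * Complex.I)) *
      Complex.exp (-(j : ℂ) * Complex.I * t) = a j * (Real.pi * Complex.exp (j * b)) := by
    simp_rw [hev, Finset.sum_mul, mul_assoc (a _)]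
    rw [intervalIntegral.integral_finsetSum
      (fun i _ => Continuous.intervalIntegrable (by fun_prop) _ _)]
    simp_rw [intervalIntegral.integral_const_mul, integral_cos_mul_exp _ j hj b]
    rw [Finset.sum_eq_single_of_mem j (Finset.mem_range.2 (by omega))]
    · simp
    · intro m _ hm
      simp [hm]
  have hle := intervalIntegral.norm_integral_le_integral_norm (μ := volume)
    (f := fun t : ℝ => p.eval (Complex.cos ((t : ℂ) - b * Complex.I)) *
      Complex.exp (-(j : ℂ) * Complex.I * t)) (by linarith [Real.pi_pos] : -Real.pi ≤ Real.pi)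
  rw [hint] at hle
  have h1 : ∀ t : ℝ, ‖p.eval (Complex.cos ((t : ℂ) - b * Complex.I)) *
      Complex.exp (-(j : ℂ) * Complex.I * t)‖ =
      ‖p.eval (Complex.cos ((t : ℂ) - b * Complex.I))‖ := by
    intro t
    rw [norm_mul, Complex.norm_exp]
    simp
  simp_rw [h1] at hle
  have h2 : ‖a j * (Real.pi * Complex.exp (j * b))‖ = ‖a j‖ * (Real.pi * Real.exp (j * b)) := by
    rw [norm_mul, norm_mul, Complex.norm_exp, Complex.norm_real, Real.norm_eq_abs,
      abs_of_pos Real.pi_pos]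
    simp
  rw [h2] at hle
  have h3 : ‖a j‖ * Real.exp (j * b) ≤ ‖a j‖ * (Real.pi * Real.exp (j * b)) := by
    refine mul_le_mul_of_nonneg_left ?_ (norm_nonneg _)
    have := Real.exp_pos (j * b)
    nlinarith [Real.pi_gt_three]
  rw [Real.exp_neg, mul_comm, ← div_eq_mul_inv, le_div_iff₀ (Real.exp_pos _)]
  exact h3.trans hle

/-- A Gaussian type integral of order `2k`. -/
theorem integral_exp_neg_pow_le {k : ℕ} (hk : 1 ≤ k) {c ν : ℝ} (hc : 0 < c) (hν : 0 < ν) :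
    ∫ t in (-Real.pi)..Real.pi, Real.exp (-(c * (ν * t) ^ (2 * k))) ≤
      (2 + 1 / c) * Real.pi / ν := by
  -- Domination by a Cauchy density gives an explicit arctangent integral with a constant
  -- independent of `ν`.
  have hpt : ∀ x : ℝ, Real.exp (-(c * x ^ (2 * k))) ≤ (2 + 1 / c) * (1 + x ^ 2)⁻¹ := by
    intro x
    have hx : (0 : ℝ) ≤ x ^ (2 * k) := by rw [pow_mul]; positivity
    have h1 : x ^ 2 ≤ 1 + x ^ (2 * k) := by
      rw [pow_mul]
      rcases le_total (x ^ 2) 1 with h | h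
      · have : (0 : ℝ) ≤ (x ^ 2) ^ k := by positivity
        linarith
      · have := le_self_pow₀ h (by omega : k ≠ 0)
        linarith
    have h2 : c * x ^ (2 * k) + 1 ≤ Real.exp (c * x ^ (2 * k)) := Real.add_one_le_exp _
    have h3 : x ^ (2 * k) ≤ 1 / c * Real.exp (c * x ^ (2 * k)) := by
      rw [one_div, ← div_eq_inv_mul, le_div_iff₀ hc]
      linarith
    have h4 : (1 : ℝ) ≤ Real.exp (c * x ^ (2 * k)) := Real.one_le_exp (by positivity)
    rw [Real.exp_neg, ← div_eq_mul_inv, le_div_iff₀ (by positivity), ← div_eq_inv_mul,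
      div_le_iff₀ (Real.exp_pos _)]
    linarith
  calc ∫ t in (-Real.pi)..Real.pi, Real.exp (-(c * (ν * t) ^ (2 * k)))
      ≤ ∫ t in (-Real.pi)..Real.pi, (2 + 1 / c) * (1 + (ν * t) ^ 2)⁻¹ := by
        refine intervalIntegral.integral_mono_on (by linarith [Real.pi_pos])
          (Continuous.intervalIntegrable (by fun_prop) _ _)
          (Continuous.intervalIntegrable ?_ _ _) fun t _ => hpt _
        exact continuous_const.mul (Continuous.inv₀ (by fun_prop) fun t => by positivity)
    _ = (2 + 1 / c) * (ν⁻¹ * (Real.arctan (ν * Real.pi) - Real.arctan (ν * -Real.pi))) := by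
        rw [intervalIntegral.integral_const_mul,
          intervalIntegral.integral_comp_mul_left (fun x => (1 + x ^ 2)⁻¹) hν.ne',
          integral_inv_one_add_sq, smul_eq_mul]
    _ ≤ (2 + 1 / c) * (ν⁻¹ * Real.pi) := by
        have h1 := Real.arctan_lt_pi_div_two (ν * Real.pi)
        have h2 := Real.neg_pi_div_two_lt_arctan (ν * -Real.pi)
        gcongr
        linarith
    _ = _ := by ring

/-! ### The symbol `1 - (L sin² w) ^ k` -/

/-- Either `d` is at most a small multiple `η a`, and the excess is absorbed in `ε a ^ m`, or `a` is
at most a multiple of `d`. This lets the perturbation caused by the imaginary shift cost only a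
small part of the main term. -/
theorem exists_add_pow_le (m : ℕ) {ε : ℝ} (hε : 0 < ε) :
    ∃ K : ℝ, 0 ≤ K ∧ ∀ a d : ℝ, 0 ≤ a → 0 ≤ d → (a + d) ^ m ≤ (1 + ε) * a ^ m + K * d ^ m := by
  have hcont : Tendsto (fun η : ℝ => (1 + η) ^ m) (nhdsWithin 0 (Ioi 0)) (nhds 1) := by
    have : ContinuousAt (fun η : ℝ => (1 + η) ^ m) 0 := by fun_prop
    have h := this.tendsto
    simp only [add_zero, one_pow] at h
    exact h.mono_left nhdsWithin_le_nhds
  obtain ⟨η, hη, hη0⟩ := ((hcont.eventually (gt_mem_nhds (by linarith : (1 : ℝ) < 1 + ε))).and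
    self_mem_nhdsWithin).exists
  have hη0 : 0 < η := hη0
  refine ⟨(1 / η + 1) ^ m, by positivity, fun a d ha hd => ?_⟩
  rcases le_total d (η * a) with h | h
  · calc (a + d) ^ m ≤ ((1 + η) * a) ^ m := by gcongr; linarith
      _ = (1 + η) ^ m * a ^ m := mul_pow _ _ _
      _ ≤ (1 + ε) * a ^ m := by gcongr
      _ ≤ _ := le_add_of_nonneg_right (by positivity)
  · have h' : a ≤ 1 / η * d := by
      rw [one_div, ← div_eq_inv_mul, le_div_iff₀ hη0]
      linarith
    calc (a + d) ^ m ≤ ((1 / η + 1) * d) ^ m := by gcongr; linarith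
      _ = (1 / η + 1) ^ m * d ^ m := mul_pow _ _ _
      _ ≤ _ := le_add_of_nonneg_left (by positivity)

/-- Expanding `z = s + (z - s)` binomially and removing `s ^ m` leaves terms with nonnegative
coefficients, so norms may replace the numbers. -/
theorem norm_pow_sub_pow_le (z s : ℂ) (m : ℕ) :
    ‖z ^ m - s ^ m‖ ≤ (‖s‖ + ‖z - s‖) ^ m - ‖s‖ ^ m := by
  induction m with
  | zero => simp
  | succ m ih =>
    have h1 : z ^ (m + 1) - s ^ (m + 1) = (z ^ m - s ^ m) * z + s ^ m * (z - s) := by ring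
    have hz : ‖z‖ ≤ ‖s‖ + ‖z - s‖ := by
      calc ‖z‖ = ‖s + (z - s)‖ := by ring_nf
        _ ≤ _ := norm_add_le _ _
    calc ‖z ^ (m + 1) - s ^ (m + 1)‖ ≤ ‖z ^ m - s ^ m‖ * ‖z‖ + ‖s‖ ^ m * ‖z - s‖ := by
          rw [h1]
          refine (norm_add_le _ _).trans ?_
          rw [norm_mul, norm_mul, norm_pow]
      _ ≤ ((‖s‖ + ‖z - s‖) ^ m - ‖s‖ ^ m) * (‖s‖ + ‖z - s‖) + ‖s‖ ^ m * ‖z - s‖ := by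
          gcongr
          exact (norm_nonneg _).trans ih
      _ = _ := by ring

/-- The addition formula reduces the difference to at most `(cosh b - 1) + sinh b = exp b - 1`. -/
theorem norm_sin_sub_le (a b : ℝ) (hb : 0 ≤ b) (hb1 : b ≤ 1) :
    ‖Complex.sin ((a : ℂ) - b * Complex.I) - (Real.sin a : ℂ)‖ ≤ 2 * b := by
  have h : Complex.sin ((a : ℂ) - b * Complex.I) - (Real.sin a : ℂ) =
      ((Real.sin a * (Real.cosh b - 1) : ℝ) : ℂ) - ((Real.cos a * Real.sinh b : ℝ) : ℂ) *
        Complex.I := by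
    rw [Complex.sin_sub, Complex.cos_mul_I, Complex.sin_mul_I]
    push_cast
    ring
  have hc : 1 ≤ Real.cosh b := Real.one_le_cosh b
  have hs : 0 ≤ Real.sinh b := Real.sinh_nonneg_iff.2 hb
  have he : Real.exp b ≤ 1 + 2 * b := by
    have := Real.exp_bound' hb hb1 (n := 2) (by norm_num)
    norm_num [Finset.sum_range_succ] at this
    nlinarith
  rw [h]
  calc _ ≤ |Real.sin a| * (Real.cosh b - 1) + |Real.cos a| * Real.sinh b := by
        refine (norm_sub_le _ _).trans ?_
        rw [norm_mul, Complex.norm_I, mul_one, Complex.norm_real, Complex.norm_real,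
          Real.norm_eq_abs, Real.norm_eq_abs, abs_mul, abs_mul, abs_of_nonneg hs,
          abs_of_nonneg (sub_nonneg.2 hc)]
    _ ≤ 1 * (Real.cosh b - 1) + 1 * Real.sinh b := by
        have := Real.abs_sin_le_one a
        have := Real.abs_cos_le_one a
        have := sub_nonneg.2 hc
        gcongr
    _ ≤ 2 * b := by
        have := Real.cosh_add_sinh b
        linarith

/-- The symbol of `M_k` off the real axis. -/
theorem exists_norm_symbol_le {k : ℕ} {L : ℝ} (hL : 0 < L) (hL2 : L ^ k < 2) :
    ∃ K c : ℝ, 0 < K ∧ 0 < c ∧ ∀ t b : ℝ, |t| ≤ Real.pi → 0 ≤ b → b ≤ 1 →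
      ‖1 - ((L : ℂ) * (1 - Complex.cos ((t : ℂ) - b * Complex.I)) / 2) ^ k‖ ≤
        Real.exp (K * b ^ (2 * k) - c * t ^ (2 * k)) := by
  set A := L ^ k with hA
  have hA0 : 0 < A := by positivity
  -- Chosen so that `|1 - u| ≤ 1 - c' u` on `[0, A]`: one sign needs `c' ≤ 1`, the other `(c' + 1) A
  -- ≤ 2`. Positivity is where `L ^ k < 2` enters.
  set c' := min 1 (2 / A - 1) with hc'
  have hc'0 : 0 < c' := by
    refine lt_min one_pos (sub_pos.2 ?_)
    rwa [lt_div_iff₀ hA0, one_mul]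
  -- Half of the gain `c'` is spent on the complex perturbation, the other half survives as decay in
  -- `t`.
  obtain ⟨K, hK0, hK⟩ := exists_add_pow_le (2 * k) (half_pos hc'0)
  refine ⟨A * K + 1, c' / 2 * A * (1 / Real.pi) ^ (2 * k), by positivity, by positivity,
    fun t b ht hb hb1 => ?_⟩
  set s : ℝ := Real.sin (t / 2) with hs
  set z : ℂ := Complex.sin (((t / 2 : ℝ) : ℂ) - ((b / 2 : ℝ) : ℂ) * Complex.I) with hz
  have hu : (L : ℂ) * (1 - Complex.cos ((t : ℂ) - b * Complex.I)) / 2 = L * z ^ 2 := by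
    rw [show (t : ℂ) - b * Complex.I =
      2 * (((t / 2 : ℝ) : ℂ) - ((b / 2 : ℝ) : ℂ) * Complex.I) by push_cast; ring,
      Complex.cos_two_mul, hz, Complex.sin_sq]
    ring
  have hd : ‖z - (s : ℂ)‖ ≤ b := by
    have := norm_sin_sub_le (t / 2) (b / 2) (by linarith) (by linarith)
    calc _ ≤ 2 * (b / 2) := this
      _ = b := by ring
  have hns : ‖(s : ℂ)‖ = |s| := by rw [Complex.norm_real, Real.norm_eq_abs]
  have hpow : |s| ^ (2 * k) = s ^ (2 * k) := by rw [pow_mul, sq_abs, ← pow_mul]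
  have hs0 : 0 ≤ s ^ (2 * k) := by rw [← hpow]; positivity
  have hs1 : s ^ (2 * k) ≤ 1 := by
    rw [← hpow]; exact pow_le_one₀ (abs_nonneg _) (Real.abs_sin_le_one _)
  have hdiff : ‖z ^ (2 * k) - (s : ℂ) ^ (2 * k)‖ ≤ c' / 2 * s ^ (2 * k) + K * b ^ (2 * k) := by
    refine (norm_pow_sub_pow_le z s (2 * k)).trans ?_
    have := hK |s| ‖z - (s : ℂ)‖ (abs_nonneg _) (norm_nonneg _)
    rw [hns]
    have h2 : K * ‖z - (s : ℂ)‖ ^ (2 * k) ≤ K * b ^ (2 * k) := by gcongr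
    rw [hpow] at *
    linarith
  have hreal : |1 - A * s ^ (2 * k)| ≤ 1 - c' * (A * s ^ (2 * k)) := by
    have hAs : 0 ≤ A * s ^ (2 * k) := by positivity
    have hAs1 : A * s ^ (2 * k) ≤ A := by nlinarith
    have h1 : c' ≤ 1 := min_le_left _ _
    have h2 : c' ≤ 2 / A - 1 := min_le_right _ _
    have h3 : (c' + 1) * A ≤ 2 := by
      have : c' + 1 ≤ 2 / A := by linarith
      rwa [le_div_iff₀ hA0] at this
    rw [abs_le]
    constructor
    · nlinarith
    · nlinarith
  have hjordan : (1 / Real.pi) ^ (2 * k) * t ^ (2 * k) ≤ s ^ (2 * k) := by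
    have h1 : 1 / Real.pi * |t| ≤ |s| := by
      have h := Real.mul_abs_le_abs_sin (x := t / 2) (by
        rw [abs_div, abs_two]; linarith)
      rw [abs_div, abs_two] at h
      calc 1 / Real.pi * |t| = 2 / Real.pi * (|t| / 2) := by ring
        _ ≤ _ := h
    have h2 : (1 / Real.pi * |t|) ^ (2 * k) ≤ |s| ^ (2 * k) := by
      have := Real.pi_pos
      gcongr
    rw [hpow, mul_pow, pow_mul |t|, sq_abs, ← pow_mul t] at h2
    exact h2
  have hmain : (1 : ℂ) - ((L : ℂ) * z ^ 2) ^ k =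
      ((1 - A * s ^ (2 * k) : ℝ) : ℂ) - A * (z ^ (2 * k) - (s : ℂ) ^ (2 * k)) := by
    rw [mul_pow, ← pow_mul, hA]
    push_cast
    ring
  have hb0 : 0 ≤ b ^ (2 * k) := by positivity
  rw [hu, hmain]
  calc _ ≤ |1 - A * s ^ (2 * k)| + A * ‖z ^ (2 * k) - (s : ℂ) ^ (2 * k)‖ := by
        refine (norm_sub_le _ _).trans ?_
        rw [norm_mul, Complex.norm_real, Complex.norm_real, Real.norm_eq_abs, Real.norm_eq_abs,
          abs_of_pos hA0]
    _ ≤ (1 - c' * (A * s ^ (2 * k))) + A * (c' / 2 * s ^ (2 * k) + K * b ^ (2 * k)) := by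
        gcongr
    _ = (A * K * b ^ (2 * k) - c' / 2 * A * s ^ (2 * k)) + 1 := by ring
    _ ≤ Real.exp (A * K * b ^ (2 * k) - c' / 2 * A * s ^ (2 * k)) := Real.add_one_le_exp _
    _ ≤ _ := by
        refine Real.exp_le_exp.2 ?_
        have : c' / 2 * A * ((1 / Real.pi) ^ (2 * k) * t ^ (2 * k)) ≤
          c' / 2 * A * s ^ (2 * k) := by gcongr
        linarith

/-! ### Tails of the Chebyshev coefficients -/

/-- A tail of a geometric series with ratio `exp (-b)`. -/
theorem sum_exp_neg_mul_le {b R : ℝ} (hb : 0 < b) (hb1 : b ≤ 1) (hR : 0 ≤ R) (N : ℕ) :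
    ∑ j ∈ (Finset.range (N + 1)).filter (fun j : ℕ => R < j), Real.exp (-(j * b)) ≤
      2 / b * Real.exp (-(R * b)) := by
  have hx1 : Real.exp (-b) < 1 := by simpa using hb
  have hm : R < (⌊R⌋₊ + 1 : ℕ) := by exact_mod_cast Nat.lt_floor_add_one R
  have hsub : (Finset.range (N + 1)).filter (fun j : ℕ => R < j) ⊆
      Finset.Ico (⌊R⌋₊ + 1) (N + 1) := by
    intro j hj
    rw [Finset.mem_filter, Finset.mem_range] at hj
    rw [Finset.mem_Ico]
    exact ⟨(Nat.floor_lt hR).2 hj.2, hj.1⟩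
  have hpow : ∀ j : ℕ, Real.exp (-(j * b)) = Real.exp (-b) ^ j := fun j => by
    rw [← Real.exp_nat_mul]; ring_nf
  have hgap : b / 2 ≤ 1 - Real.exp (-b) := by
    have h1 : b + 1 ≤ Real.exp b := Real.add_one_le_exp b
    have h2 : Real.exp (-b) ≤ 1 / (b + 1) := by
      rw [Real.exp_neg, ← one_div]
      exact one_div_le_one_div_of_le (by linarith) h1
    have h3 : 1 / (b + 1) ≤ 1 - b / 2 := by
      rw [div_le_iff₀ (by linarith)]
      nlinarith
    linarith
  calc _ ≤ ∑ j ∈ Finset.Ico (⌊R⌋₊ + 1) (N + 1), Real.exp (-(j * b)) :=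
        Finset.sum_le_sum_of_subset_of_nonneg hsub fun _ _ _ => (Real.exp_pos _).le
    _ = ∑ j ∈ Finset.Ico (⌊R⌋₊ + 1) (N + 1), Real.exp (-b) ^ j := by simp_rw [hpow]
    _ ≤ Real.exp (-b) ^ (⌊R⌋₊ + 1) / (1 - Real.exp (-b)) :=
        geom_sum_Ico_le_of_lt_one (Real.exp_pos _).le hx1
    _ ≤ Real.exp (-(R * b)) / (b / 2) := by
        rw [← hpow]
        gcongr
    _ = _ := by field_simp

/-- The polynomial `(1 - (L (1 - X) / 2) ^ k) ^ n`, which represents `M_k ^ n` in the variable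
`1 - (2 / L) (1 - M)`. -/
noncomputable def rescaledSymbol (k : ℕ) (L : ℝ) (n : ℕ) : Polynomial ℂ :=
  (1 - (Polynomial.C ((L : ℂ) / 2) * (1 - Polynomial.X)) ^ k) ^ n

theorem eval_rescaledSymbol (k : ℕ) (L : ℝ) (n : ℕ) (w : ℂ) :
    (rescaledSymbol k L n).eval w = (1 - ((L : ℂ) * (1 - w) / 2) ^ k) ^ n := by
  simp only [rescaledSymbol, Polynomial.eval_pow, Polynomial.eval_sub, Polynomial.eval_one,
    Polynomial.eval_mul, Polynomial.eval_C, Polynomial.eval_X]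
  ring_nf

theorem natDegree_rescaledSymbol_le (k : ℕ) (L : ℝ) (n : ℕ) :
    (rescaledSymbol k L n).natDegree ≤ k * n := by
  unfold rescaledSymbol
  refine (Polynomial.natDegree_pow_le).trans ?_
  rw [mul_comm]
  refine Nat.mul_le_mul_right n ?_
  refine (Polynomial.natDegree_sub_le _ _).trans (max_le (by simp) ?_)
  refine (Polynomial.natDegree_pow_le).trans ?_
  refine (Nat.mul_le_mul_left k ?_).trans (mul_one k).le
  refine (Polynomial.natDegree_C_mul_le _ _).trans ?_
  exact (Polynomial.natDegree_sub_le _ _).trans (max_le (by simp) Polynomial.natDegree_X_le)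

/-- Tails of the Chebyshev expansion of the symbol of `M_k ^ n`. -/
theorem exists_sum_chebyshev_coeff_le {k : ℕ} (hk : 1 ≤ k) {L : ℝ} (hL : 0 < L)
    (hL2 : L ^ k < 2) :
    ∃ C c : ℝ, 0 < C ∧ 0 < c ∧ ∀ n : ℕ, 1 ≤ n → ∀ a : ℕ → ℂ,
      rescaledSymbol k L n = ∑ j ∈ Finset.range (k * n + 1),
        Polynomial.C (a j) * Polynomial.Chebyshev.T ℂ j →
      ∀ R : ℝ, 0 ≤ R → (n : ℝ) ≤ R ^ (2 * k) →
        ∑ j ∈ (Finset.range (k * n + 1)).filter (fun j : ℕ => R < j), ‖a j‖ ≤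
          C * Real.exp (-(c * (R * (R / n) ^ (1 / (2 * k - 1) : ℝ)))) := by
  obtain ⟨K, c, hK, hc, hsym⟩ := exists_norm_symbol_le (k := k) hL hL2
  -- Small enough for three purposes: `2 K η ≤ 1` makes the growth of the symbol cost at most half
  -- of the gain `R b`, `k η ≤ 1` keeps the shift `b ≤ 1`, and `η ≤ 1`.
  set η : ℝ := 1 / (2 * K + k + 1) with hη
  set D : ℝ := (2 + 1 / c) * Real.pi with hD
  have hk0 : (1 : ℝ) ≤ k := by exact_mod_cast hk
  have hden : 0 < 2 * K + k + 1 := by positivity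
  have hη0 : 0 < η := by positivity
  have hD0 : 0 < D := by have := Real.pi_pos; positivity
  have hηK : η * (2 * K) ≤ 1 := by
    rw [hη, one_div, ← div_eq_inv_mul, div_le_iff₀ hden]; linarith
  have hηk : η * k ≤ 1 := by
    rw [hη, one_div, ← div_eq_inv_mul, div_le_iff₀ hden]; linarith
  have hη1 : η ≤ 1 := by
    rw [hη, div_le_iff₀ hden]; linarith
  have hηpow : η ^ (2 * k - 1) ≤ η := pow_le_of_le_one hη0.le hη1 (by omega)
  refine ⟨2 * D / η, η / 2, by positivity, by positivity, fun n hn a ha R hR hnR => ?_⟩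
  have hn0 : (0 : ℝ) < n := by exact_mod_cast hn
  have hR0 : 0 < R := by
    rcases hR.eq_or_lt with h | h
    · rw [← h, zero_pow (by omega)] at hnR
      linarith
    · exact h
  set h : ℝ := (R / n) ^ (1 / (2 * k - 1) : ℝ) with hh
  have hh0 : 0 < h := by positivity
  have hcast : ((2 * k - 1 : ℕ) : ℝ) = 2 * k - 1 := by
    rw [Nat.cast_sub (by omega)]; push_cast; ring
  have hhpow : h ^ (2 * k - 1) = R / n := by
    rw [hh, ← Real.rpow_natCast, hcast, ← Real.rpow_mul (by positivity), one_div,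
      inv_mul_cancel₀ (by linarith), Real.rpow_one]
  -- Beyond the degree `k n` the tail is empty; otherwise `R / n ≤ k`, which is what bounds the
  -- shift `b`.
  rcases lt_or_ge (k * n : ℝ) R with hRbig | hRle
  · rw [Finset.filter_eq_empty_iff.2, Finset.sum_empty]
    · positivity
    · intro j hj hRj
      have : (j : ℝ) ≤ (k * n : ℕ) := by
        exact_mod_cast Nat.lt_succ_iff.1 (Finset.mem_range.1 hj)
      push_cast at this
      linarith
  set b : ℝ := η * h with hb
  have hb0 : 0 < b := by positivity
  have hbpow : b ^ (2 * k - 1) = η ^ (2 * k - 1) * (R / n) := by rw [hb, mul_pow, hhpow]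
  have hb1 : b ≤ 1 := by
    have h1 : b ^ (2 * k - 1) ≤ 1 := by
      rw [hbpow]
      have : R / n ≤ k := by rwa [div_le_iff₀ hn0]
      calc η ^ (2 * k - 1) * (R / n) ≤ η * k := by gcongr
        _ ≤ 1 := hηk
    by_contra hcon
    exact absurd h1 (not_le.2 (one_lt_pow₀ (not_le.1 hcon) (by omega)))
  have hbexp : n * (K * b ^ (2 * k)) ≤ R * b / 2 := by
    have h2k : b ^ (2 * k) = b ^ (2 * k - 1) * b := by
      rw [← pow_succ]; congr 1; omega
    rw [h2k, hbpow]
    have : η ^ (2 * k - 1) * K ≤ 1 / 2 := by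
      calc η ^ (2 * k - 1) * K ≤ η * K := by gcongr
        _ ≤ 1 / 2 := by linarith
    calc n * (K * (η ^ (2 * k - 1) * (R / n) * b)) = (η ^ (2 * k - 1) * K) * (R * b) := by
          field_simp
      _ ≤ 1 / 2 * (R * b) := by gcongr
      _ = _ := by ring
  -- The integral over `t` concentrates on the scale `1 / ν`. This factor must compensate the `1 /
  -- b` of the geometric series, which is possible because `(ν h)^(2k-1) = R / ν ≥ 1`.
  set ν : ℝ := (n : ℝ) ^ (1 / (2 * k) : ℝ) with hν
  have hν0 : 0 < ν := by positivity
  have hνpow : ν ^ (2 * k) = n := by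
    rw [hν, ← Real.rpow_natCast, ← Real.rpow_mul hn0.le]
    push_cast
    rw [one_div, inv_mul_cancel₀ (by positivity), Real.rpow_one]
  have hνR : ν ≤ R := by
    rw [← hνpow] at hnR
    exact le_of_pow_le_pow_left₀ (by omega) hR hnR
  have hνh : 1 ≤ ν * h := by
    have h1 : 1 ≤ (ν * h) ^ (2 * k - 1) := by
      have h2 : ν ^ (2 * k) = ν ^ (2 * k - 1) * ν := by
        rw [← pow_succ]; congr 1; omega
      rw [mul_pow, hhpow, ← hνpow, h2, ← div_div, mul_div_assoc', mul_div_cancel₀ _ (by positivity),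
        le_div_iff₀ hν0, one_mul]
      exact hνR
    by_contra hcon
    exact absurd h1 (not_le.2 (pow_lt_one₀ (by positivity) (not_le.1 hcon) (by omega)))
  have hcoef : ∀ j ∈ (Finset.range (k * n + 1)).filter (fun j : ℕ => R < j),
      ‖a j‖ ≤ D / ν * Real.exp (R * b / 2) * Real.exp (-(j * b)) := by
    intro j hj
    rw [Finset.mem_filter, Finset.mem_range] at hj
    have hj1 : 1 ≤ j := by
      have : (0 : ℝ) < j := hR0.trans hj.2
      exact_mod_cast this
    refine (norm_chebyshev_coeff_le ha hj1 (by omega) b).trans ?_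
    rw [mul_comm]
    gcongr
    calc ∫ t in (-Real.pi)..Real.pi,
          ‖(rescaledSymbol k L n).eval (Complex.cos ((t : ℂ) - b * Complex.I))‖
        ≤ ∫ t in (-Real.pi)..Real.pi,
          Real.exp (R * b / 2) * Real.exp (-(c * (ν * t) ^ (2 * k))) := by
          refine intervalIntegral.integral_mono_on (by linarith [Real.pi_pos])
            (Continuous.intervalIntegrable (by fun_prop) _ _)
            (Continuous.intervalIntegrable (by fun_prop) _ _) fun t ht => ?_
          rw [eval_rescaledSymbol, norm_pow]
          calc _ ≤ Real.exp (K * b ^ (2 * k) - c * t ^ (2 * k)) ^ n := by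
                gcongr
                exact hsym t b (abs_le.2 ht) hb0.le hb1
            _ = Real.exp (n * (K * b ^ (2 * k)) + -(c * (ν * t) ^ (2 * k))) := by
                rw [← Real.exp_nat_mul, mul_pow ν t, hνpow]
                congr 1
                ring
            _ ≤ _ := by
                rw [← Real.exp_add]
                gcongr
      _ ≤ Real.exp (R * b / 2) * (D / ν) := by
          rw [intervalIntegral.integral_const_mul]
          gcongr
          exact integral_exp_neg_pow_le hk hc hν0
      _ = _ := mul_comm _ _
  calc _ ≤ ∑ j ∈ (Finset.range (k * n + 1)).filter (fun j : ℕ => R < j),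
        D / ν * Real.exp (R * b / 2) * Real.exp (-(j * b)) := Finset.sum_le_sum hcoef
    _ ≤ D / ν * Real.exp (R * b / 2) * (2 / b * Real.exp (-(R * b))) := by
        rw [← Finset.mul_sum]
        gcongr
        exact sum_exp_neg_mul_le hb0 hb1 hR _
    _ = 2 * D / η / (ν * h) * Real.exp (-(η / 2 * (R * h))) := by
        have : Real.exp (-(η / 2 * (R * h))) = Real.exp (R * b / 2) * Real.exp (-(R * b)) := by
          rw [← Real.exp_add, hb]; ring_nf
        rw [this, hb]
        field_simp
    _ ≤ _ := by
        refine mul_le_mul_of_nonneg_right ?_ (Real.exp_pos _).le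
        exact div_le_self (by positivity) hνh

/-! ### Pointwise values in `ℓ²(X, π)` -/

/-- Points have positive mass, so a null set is empty and classes in `Lp` have genuine values. -/
theorem forall_of_ae {X : Type*} [MeasurableSpace X] {π : Measure X} [IsPositiveOnPoints π] {p : X → Prop} (h : ∀ᵐ y ∂π, p y)
    (y : X) : p y := by
  by_contra hy
  have h0 : π {y} = 0 := measure_mono_null (by simpa using hy) (ae_iff.1 h)
  exact (IsPositiveOnPoints.pos (π := π) y).ne' h0

theorem measureReal_singleton_pos {X : Type*} [MeasurableSpace X] (π : Measure X) [IsPositiveOnPoints π] (x : X) :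
    0 < π.real {x} :=
  ENNReal.toReal_pos (IsPositiveOnPoints.pos x).ne' (IsPositiveOnPoints.lt_top x).ne

theorem indicatorConstLp_apply_of_mem {X : Type*} [MeasurableSpace X] {π : Measure X}
    [IsPositiveOnPoints π] {s : Set X}
    (hs : MeasurableSet s) (hπ : π s ≠ ∞) {y : X} (hy : y ∈ s) :
    (indicatorConstLp 2 hs hπ (1 : ℂ) : X → ℂ) y = 1 :=
  (forall_of_ae (indicatorConstLp_coeFn (p := 2) (hs := hs) (hμs := hπ) (c := (1 : ℂ))) y).trans
    (indicator_of_mem hy _)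

theorem norm_indicatorConstLp_one {X : Type*} [MeasurableSpace X] {π : Measure X} {s : Set X} (hs : MeasurableSet s)
    (hπ : π s ≠ ∞) : ‖indicatorConstLp 2 hs hπ (1 : ℂ)‖ = √(π.real s) := by
  rw [norm_indicatorConstLp two_ne_zero ENNReal.ofNat_ne_top, norm_one, one_mul,
    Real.sqrt_eq_rpow]
  norm_num

section

variable {X : Type*} [MeasurableSpace X] [MeasurableSingletonClass X]

/-- The evaluation at a point of the elements of `ℓ²(X, π)`. -/
noncomputable def evalAt (π : Measure X) [IsPositiveOnPoints π] (x : X) : Lp ℂ 2 π →L[ℂ] ℂ :=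
  ((π.real {x} : ℂ)⁻¹) • innerSL ℂ (delta π x)

theorem evalAt_apply {π : Measure X} [IsPositiveOnPoints π] (x : X) (f : Lp ℂ 2 π) :
    evalAt π x f = f x := by
  have h : (π.real {x} : ℂ) ≠ 0 := by exact_mod_cast (measureReal_singleton_pos π x).ne'
  rw [evalAt, smul_apply, innerSL_apply_apply, apply_eq_inner, smul_eq_mul,
    inv_mul_cancel_left₀ h]

theorem delta_apply_of_ne {π : Measure X} [IsPositiveOnPoints π] {x y : X} (h : y ≠ x) :
    delta π x y = 0 :=
  (forall_of_ae (indicatorConstLp_coeFn (p := 2) (hs := measurableSet_singleton x)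
    (hμs := (IsPositiveOnPoints.lt_top (π := π) x).ne) (c := (1 : ℂ))) y).trans
    (indicator_of_notMem (by simpa using h) _)

theorem norm_delta (π : Measure X) [IsPositiveOnPoints π] (x : X) :
    ‖delta π x‖ = √(π.real {x}) :=
  norm_indicatorConstLp_one _ _

theorem aeval_apply_eq_sum {E : Type*} [NormedAddCommGroup E] [NormedSpace ℂ E] (M : E →L[ℂ] E)
    (q : Polynomial ℂ) (f : E) :
    Polynomial.aeval M q f = ∑ i ∈ Finset.range (q.natDegree + 1), q.coeff i • (M ^ i) f := by
  rw [Polynomial.aeval_eq_sum_range, sum_apply]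
  simp

end

/-! ### Spectral bound, finite propagation and conservation of constants -/

/-- By the continuous functional calculus for the normal operator `M`, the norm of `q(M)` is
controlled by `|q|` on the spectrum. -/
theorem IsStochasticHermitianContraction.norm_aeval_le {X : Type*} [MetricSpace X]
    [MeasurableSpace X] [MeasurableSingletonClass X] {π : Measure X} [IsPositiveOnPoints π]
    {s₀ : ℝ} {M : Lp ℂ 2 π →L[ℂ] Lp ℂ 2 π} (hM : IsStochasticHermitianContraction s₀ M) (q : Polynomial ℂ)
    (h : ∀ t : ℝ, 1 - 2 * s₀ ≤ t → t ≤ 1 → ‖q.eval (t : ℂ)‖ ≤ 1) :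
    ‖Polynomial.aeval M q‖ ≤ 1 := by
  have := hM.hermitian.isStarNormal
  rw [← cfc_polynomial (q := q) (a := M)]
  refine norm_cfc_le zero_le_one fun z hz => ?_
  obtain ⟨t, ht, rfl⟩ := hM.spectrum_subset hz
  exact h t ht.1.le ht.2

section

variable {X : Type*} [MetricSpace X] [Countable X] [MeasurableSpace X] [MeasurableSingletonClass X]
  {π : Measure X} [IsPositiveOnPoints π] {s₀ : ℝ} {M : Lp ℂ 2 π →L[ℂ] Lp ℂ 2 π}

namespace IsStochasticHermitianContraction

/-- Each application of `M` enlarges the support by at most `1`. -/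
theorem pow_delta_eq_zero (hM : IsStochasticHermitianContraction s₀ M) (x : X) (i : ℕ) :
    ∀ y : X, (i : ℝ) < dist x y → (M ^ i) (delta π x) y = 0 := by
  induction i with
  | zero =>
    intro y hy
    rw [pow_zero, one_apply_eq_self]
    refine delta_apply_of_ne ?_
    rintro rfl
    simp at hy
  | succ i ih =>
    intro y hy
    have h := hasSum_entry M ((M ^ i) (delta π x)) y
    have h0 : ∀ z, entry M y z * (M ^ i) (delta π x) z = 0 := by
      intro z
      rcases lt_or_ge (1 : ℝ) (dist y z) with hz | hz
      · rw [hM.finite_range y z hz, zero_mul]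
      · have := dist_triangle x z y
        rw [dist_comm z y] at this
        push_cast at hy
        rw [ih z (by linarith), mul_zero]
    rw [pow_succ', mul_apply_eq_comp]
    simp_rw [h0] at h
    exact h.unique hasSum_zero

/-- Finite propagation speed. -/
theorem aeval_delta_eq_zero (hM : IsStochasticHermitianContraction s₀ M) (q : Polynomial ℂ)
    {x y : X} (h : (q.natDegree : ℝ) < dist x y) : Polynomial.aeval M q (delta π x) y = 0 := by
  rw [← evalAt_apply, aeval_apply_eq_sum, map_sum]
  refine Finset.sum_eq_zero fun i hi => ?_
  have : (i : ℝ) ≤ q.natDegree := by exact_mod_cast Nat.lt_succ_iff.1 (Finset.mem_range.1 hi)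
  rw [map_smul, evalAt_apply, hM.pow_delta_eq_zero x i y (by linarith), smul_zero]

/-- A local form of `M 1 = 1`, needed because the constant function need not be in `ℓ²`: the value
of `M ^ i f` at `z` only sees `f` on `B(z, i)`. -/
theorem pow_indicator_eq_one (hM : IsStochasticHermitianContraction s₀ M) {x : X} {R : ℝ}
    (hπ : π (Metric.closedBall x R) ≠ ∞) (i : ℕ) :
    ∀ z : X, dist z x + i ≤ R → (M ^ i) (indicatorConstLp 2
      (Metric.closedBall x R).to_countable.measurableSet hπ (1 : ℂ)) z = 1 := by
  induction i with
  | zero =>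
    intro z hz
    rw [pow_zero, one_apply_eq_self]
    exact indicatorConstLp_apply_of_mem _ hπ (by simpa using hz)
  | succ i ih =>
    intro z hz
    have h := hasSum_entry M ((M ^ i) (indicatorConstLp 2
      (Metric.closedBall x R).to_countable.measurableSet hπ (1 : ℂ))) z
    rw [pow_succ', mul_apply_eq_comp]
    refine h.unique ?_
    convert hM.row_sum z using 2 with y
    rcases lt_or_ge (1 : ℝ) (dist z y) with hy | hy
    · rw [hM.finite_range z y hy, zero_mul]
    · have := dist_triangle y z x
      rw [dist_comm y z] at this
      push_cast at hz
      rw [ih y (by linarith), mul_one]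

theorem aeval_indicator_eq_eval_one (hM : IsStochasticHermitianContraction s₀ M)
    (q : Polynomial ℂ) {x : X} {R : ℝ} (hπ : π (Metric.closedBall x R) ≠ ∞)
    (h : (q.natDegree : ℝ) ≤ R) :
    Polynomial.aeval M q (indicatorConstLp 2
      (Metric.closedBall x R).to_countable.measurableSet hπ (1 : ℂ)) x = q.eval 1 := by
  rw [← evalAt_apply, aeval_apply_eq_sum, map_sum, Polynomial.eval_eq_sum_range]
  refine Finset.sum_congr rfl fun i hi => ?_
  have : (i : ℝ) ≤ q.natDegree := by exact_mod_cast Nat.lt_succ_iff.1 (Finset.mem_range.1 hi)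
  rw [map_smul, evalAt_apply, hM.pow_indicator_eq_one hπ i x (by rw [dist_self]; linarith)]
  simp

end IsStochasticHermitianContraction

end

/-! ### `M_k ^ n` in terms of rescaled Chebyshev polynomials -/

theorem powLaplace_pow_eq_aeval {X : Type*} [MeasurableSpace X] {π : Measure X}
    (M : Lp ℂ 2 π →L[ℂ] Lp ℂ 2 π) (k n : ℕ) :
    powLaplace k M ^ n = Polynomial.aeval M ((1 - (1 - Polynomial.X : Polynomial ℂ) ^ k) ^ n) := by
  simp [powLaplace]

theorem isSelfAdjoint_powLaplace {X : Type*} [MeasurableSpace X] {π : Measure X}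
    {M : Lp ℂ 2 π →L[ℂ] Lp ℂ 2 π} (hM : IsSelfAdjoint M) (k : ℕ) :
    IsSelfAdjoint (powLaplace k M) :=
  (IsSelfAdjoint.one _).sub (((IsSelfAdjoint.one _).sub hM).pow k)

/-- The Chebyshev polynomial `T_j` of the variable `1 - (2 / L) (1 - X)`. -/
noncomputable def rescaledChebyshev (L : ℝ) (j : ℕ) : Polynomial ℂ :=
  (Polynomial.Chebyshev.T ℂ j).comp (1 - Polynomial.C ((2 / L : ℝ) : ℂ) * (1 - Polynomial.X))

theorem natDegree_rescaledChebyshev_le (L : ℝ) (j : ℕ) :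
    (rescaledChebyshev L j).natDegree ≤ j := by
  unfold rescaledChebyshev
  refine Polynomial.natDegree_comp_le.trans ?_
  rw [Polynomial.Chebyshev.natDegree_T, Int.natAbs_natCast]
  refine (Nat.mul_le_mul_left j ?_).trans (mul_one j).le
  refine (Polynomial.natDegree_sub_le _ _).trans (max_le (by simp) ?_)
  refine (Polynomial.natDegree_C_mul_le _ _).trans ?_
  exact (Polynomial.natDegree_sub_le _ _).trans (max_le (by simp) Polynomial.natDegree_X_le)

/-- The affine change of variable sends `[1 - L, 1]` to `[-1, 1]`, where `|T_j| ≤ 1`. With `L = 2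
s₀` this makes every rescaled Chebyshev polynomial of `M` a contraction. -/
theorem norm_eval_rescaledChebyshev_le {L : ℝ} (hL : 0 < L) (j : ℕ) {t : ℝ} (h1 : 1 - L ≤ t)
    (h2 : t ≤ 1) : ‖(rescaledChebyshev L j).eval (t : ℂ)‖ ≤ 1 := by
  have h : (rescaledChebyshev L j).eval (t : ℂ) =
      (((Polynomial.Chebyshev.T ℝ j).eval (1 - 2 / L * (1 - t)) : ℝ) : ℂ) := by
    rw [Polynomial.Chebyshev.complex_ofReal_eval_T]
    simp [rescaledChebyshev]
  rw [h, Complex.norm_real, Real.norm_eq_abs]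
  refine Polynomial.Chebyshev.abs_eval_T_real_le_one _ ?_
  have h3 : 0 ≤ 2 / L * (1 - t) := mul_nonneg (by positivity) (by linarith)
  have h4 : 2 / L * (1 - t) ≤ 2 := by
    rw [div_mul_eq_mul_div, div_le_iff₀ hL]; linarith
  rw [abs_le]
  constructor <;> linarith

/-- The Chebyshev expansion of the symbol of `M_k ^ n`, in the original variable. -/
theorem symbol_eq_sum {k n N : ℕ} {L : ℝ} (hL : 0 < L) {a : ℕ → ℂ}
    (ha : rescaledSymbol k L n = ∑ j ∈ Finset.range (N + 1),
        Polynomial.C (a j) * Polynomial.Chebyshev.T ℂ j) :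
    (1 - (1 - Polynomial.X : Polynomial ℂ) ^ k) ^ n =
      ∑ j ∈ Finset.range (N + 1), Polynomial.C (a j) * rescaledChebyshev L j := by
  have h := congrArg (fun p => Polynomial.comp p
    (1 - Polynomial.C ((2 / L : ℝ) : ℂ) * (1 - Polynomial.X))) ha
  simp only [Polynomial.sum_comp, Polynomial.mul_comp, Polynomial.C_comp] at h
  have hc : Polynomial.C ((L : ℂ) / 2) * Polynomial.C ((2 / L : ℝ) : ℂ) = 1 := by
    have : (L : ℂ) ≠ 0 := by exact_mod_cast hL.ne'
    rw [← Polynomial.C_mul, ← Polynomial.C_1]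
    congr 1
    push_cast
    field_simp
  rw [rescaledSymbol] at h
  simp only [Polynomial.pow_comp, Polynomial.sub_comp, Polynomial.mul_comp, Polynomial.one_comp,
    Polynomial.C_comp, Polynomial.X_comp, sub_sub_cancel, ← mul_assoc, hc, one_mul] at h
  exact h

theorem natDegree_symbol_le (k n : ℕ) :
    ((1 - (1 - Polynomial.X : Polynomial ℂ) ^ k) ^ n).natDegree ≤ k * n := by
  refine (Polynomial.natDegree_pow_le).trans ?_
  rw [mul_comm]
  refine Nat.mul_le_mul_right n ?_
  refine (Polynomial.natDegree_sub_le _ _).trans (max_le (by simp) ?_)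
  refine (Polynomial.natDegree_pow_le).trans ?_
  refine (Nat.mul_le_mul_left k ?_).trans (mul_one k).le
  exact (Polynomial.natDegree_sub_le _ _).trans (max_le (by simp) Polynomial.natDegree_X_le)

/-! ### Concentration of mass and the diagonal entry -/

/-- Telescoping over dyadic annuli, so that each scale can be estimated with its own volume. -/
theorem norm_setIntegral_closedBall_sub_le {X : Type*} [MetricSpace X] [Countable X]
    [MeasurableSpace X] [MeasurableSingletonClass X] {π : Measure X} (g : Lp ℂ 2 π) {x : X} {r : ℝ} (hr : 0 ≤ r)
    (hπ : ∀ t, π (Metric.closedBall x t) ≠ ∞) {e : ℕ → ℝ}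
    (he : ∀ i : ℕ, ‖∫ y in Metric.closedBall x (2 ^ (i + 1) * r) \ Metric.closedBall x (2 ^ i * r),
      g y ∂π‖ ≤ e i) (m : ℕ) :
    ‖∫ y in Metric.closedBall x (2 ^ m * r), g y ∂π - ∫ y in Metric.closedBall x r, g y ∂π‖ ≤
      ∑ i ∈ Finset.range m, e i := by
  induction m with
  | zero => simp
  | succ m ih =>
    have hsub : Metric.closedBall x (2 ^ m * r) ⊆ Metric.closedBall x (2 ^ (m + 1) * r) := by
      refine Metric.closedBall_subset_closedBall ?_
      rw [pow_succ, mul_assoc]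
      have : (0 : ℝ) < 2 ^ m := by positivity
      nlinarith
    have h := he m
    rw [setIntegral_sdiff (Metric.closedBall x (2 ^ m * r)).to_countable.measurableSet
      (integrableOn_Lp_of_measure_ne_top g fact_one_le_two_ennreal.elim (hπ _)) hsub] at h
    rw [Finset.sum_range_succ]
    exact (norm_sub_le_norm_sub_add_norm_sub _ _ _).trans
      ((add_le_add h ih).trans_eq (add_comm _ _))

section

variable {X : Type*} [MetricSpace X] [Countable X] [MeasurableSpace X] [MeasurableSingletonClass X]
  {π : Measure X} [IsPositiveOnPoints π] {s₀ : ℝ} {M : Lp ℂ 2 π →L[ℂ] Lp ℂ 2 π}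

namespace IsStochasticHermitianContraction

/-- An off-diagonal estimate: only the terms of large degree of an expansion of a polynomial `q`
contribute to `q(M) δ_x` far from `x`. -/
theorem norm_setIntegral_aeval_le (hM : IsStochasticHermitianContraction s₀ M) {N : ℕ}
    {a : ℕ → ℂ} {q : ℕ → Polynomial ℂ} (hq : ∀ j, (q j).natDegree ≤ j)
    (hqM : ∀ j, ‖Polynomial.aeval M (q j)‖ ≤ 1) {x : X} {R : ℝ} {A : Set X}
    (hA : ∀ y ∈ A, R < dist x y) (hπ : π A ≠ ∞) :
    ‖∫ y in A, Polynomial.aeval M (∑ j ∈ Finset.range (N + 1), Polynomial.C (a j) * q j)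
        (delta π x) y ∂π‖ ≤
      (∑ j ∈ (Finset.range (N + 1)).filter (fun j : ℕ => R < j), ‖a j‖) *
        (√(π.real {x}) * √(π.real A)) := by
  have hAm : MeasurableSet A := A.to_countable.measurableSet
  have hterm : ∀ j, j ∉ (Finset.range (N + 1)).filter (fun j : ℕ => R < j) →
      j ∈ Finset.range (N + 1) →
      inner ℂ (indicatorConstLp 2 hAm hπ (1 : ℂ)) (Polynomial.aeval M (q j) (delta π x)) = 0 := by
    intro j hj hjN
    have hjR : (j : ℝ) ≤ R := by
      by_contra hcon
      exact hj (Finset.mem_filter.2 ⟨hjN, not_le.1 hcon⟩)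
    rw [L2.inner_indicatorConstLp_one]
    refine setIntegral_eq_zero_of_forall_eq_zero fun y hy => hM.aeval_delta_eq_zero _ ?_
    have : ((q j).natDegree : ℝ) ≤ j := by exact_mod_cast hq j
    linarith [hA y hy]
  rw [← L2.inner_indicatorConstLp_one (𝕜 := ℂ) hAm hπ, map_sum, sum_apply, inner_sum]
  simp_rw [map_mul, Polynomial.aeval_C, mul_apply_eq_comp, Algebra.algebraMap_eq_smul_one,
    smul_apply, one_apply_eq_self, inner_smul_right]
  rw [← Finset.sum_filter_add_sum_filter_not _ (fun j : ℕ => R < j),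
    Finset.sum_eq_zero (s := (Finset.range (N + 1)).filter (fun j : ℕ => ¬ R < j)), add_zero,
    Finset.sum_mul]
  · refine norm_sum_le_of_le _ fun j _ => ?_
    rw [norm_mul]
    gcongr
    refine (norm_inner_le_norm _ _).trans ?_
    rw [norm_indicatorConstLp_one, mul_comm, ← norm_delta π x]
    gcongr
    exact (ContinuousLinearMap.le_opNorm _ _).trans
      (mul_le_of_le_one_left (norm_nonneg _) (hqM j))
  · intro j hj
    rw [Finset.mem_filter] at hj
    rw [hterm j (fun h => hj.2 (Finset.mem_filter.1 h).2) hj.1, mul_zero]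

/-- Conservation of mass: by self-adjointness the operator moves onto the indicator of the ball,
which is so large that the value at `x` is that of the symbol at `1`, namely `1`. -/
theorem setIntegral_powLaplace_pow_eq (hM : IsStochasticHermitianContraction s₀ M) {k n : ℕ}
    (hk : 1 ≤ k) {x : X} {R : ℝ} (hπ : π (Metric.closedBall x R) ≠ ∞) (hR : (k * n : ℝ) ≤ R) :
    ∫ y in Metric.closedBall x R, (powLaplace k M ^ n) (delta π x) y ∂π = π.real {x} := by
  have hsa := (isSelfAdjoint_powLaplace hM.hermitian k).pow n
  rw [← L2.inner_indicatorConstLp_one (𝕜 := ℂ)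
    (Metric.closedBall x R).to_countable.measurableSet hπ,
    ← ContinuousLinearMap.adjoint_inner_left, hsa.adjoint_eq, ← inner_conj_symm, apply_eq_inner,
    powLaplace_pow_eq_aeval, hM.aeval_indicator_eq_eval_one _ hπ]
  · have : k ≠ 0 := by omega
    simp [this]
  · refine le_trans ?_ hR
    exact_mod_cast natDegree_symbol_le k n

/-- If the mass of `M_k ^ n δ_x` is concentrated near `x`, then `M_k ^ (2 n) (x, x)` is large. -/
theorem le_entry_of_concentration (hM : IsStochasticHermitianContraction s₀ M) {k n : ℕ}
    (hk : 1 ≤ k) {x : X} {r : ℝ} (hr : 0 < r) (hπ : ∀ t, π (Metric.closedBall x t) ≠ ∞)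
    (h : ∀ m : ℕ,
      ‖∫ y in Metric.closedBall x (2 ^ m * r), (powLaplace k M ^ n) (delta π x) y ∂π -
        ∫ y in Metric.closedBall x r, (powLaplace k M ^ n) (delta π x) y ∂π‖ ≤ π.real {x} / 2) :
    ((1 / 4 * (π.real {x} / π.real (Metric.closedBall x r)) : ℝ) : ℂ) ≤
      entry (powLaplace k M ^ (2 * n)) x x := by
  set T := powLaplace k M ^ n with hT
  set g := T (delta π x) with hg
  have hp := measureReal_singleton_pos π x
  have hsa : IsSelfAdjoint T := (isSelfAdjoint_powLaplace hM.hermitian k).pow n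
  -- At this scale the ball has radius at least the degree `k n`, so it carries the full mass
  -- `π(x)`.
  obtain ⟨m, hm⟩ := pow_unbounded_of_one_lt (k * n / r : ℝ) one_lt_two
  have hm' : (k * n : ℝ) ≤ 2 ^ m * r := by
    rw [div_lt_iff₀ hr] at hm
    exact hm.le
  have hlow := h m
  rw [hM.setIntegral_powLaplace_pow_eq hk (hπ _) hm',
    ← L2.inner_indicatorConstLp_one (𝕜 := ℂ)
      (Metric.closedBall x r).to_countable.measurableSet (hπ r)] at hlow
  have hcs := norm_inner_le_norm (𝕜 := ℂ) (indicatorConstLp 2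
    (Metric.closedBall x r).to_countable.measurableSet (hπ r) (1 : ℂ)) g
  rw [norm_indicatorConstLp_one] at hcs
  have hhalf : π.real {x} / 2 ≤ √(π.real (Metric.closedBall x r)) * ‖g‖ := by
    refine le_trans ?_ hcs
    have h1 := norm_sub_norm_le (π.real {x} : ℂ) (inner ℂ (indicatorConstLp 2
      (Metric.closedBall x r).to_countable.measurableSet (hπ r) (1 : ℂ)) g)
    have h2 : ‖(π.real {x} : ℂ)‖ = π.real {x} := by
      rw [Complex.norm_real, Real.norm_eq_abs, abs_of_pos hp]
    rw [h2] at h1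
    linarith
  have hV : 0 < π.real (Metric.closedBall x r) :=
    hp.trans_le (measureReal_mono (singleton_subset_iff.2 (Metric.mem_closedBall_self hr.le)) (hπ r))
  -- Splitting `2 n = n + n` and using self-adjointness also shows that the entry is real, as the
  -- order on `ℂ` requires.
  have hentry : entry (powLaplace k M ^ (2 * n)) x x = ((‖g‖ ^ 2 / π.real {x} : ℝ) : ℂ) := by
    have h1 : (π.real {x} : ℂ) * entry (powLaplace k M ^ (2 * n)) x x = ((‖g‖ ^ 2 : ℝ) : ℂ) := by
      rw [entry, ← apply_eq_inner, two_mul, pow_add, ← hT, mul_apply_eq_comp,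
        ← ContinuousLinearMap.adjoint_inner_left, hsa.adjoint_eq, ← hg,
        inner_self_eq_norm_sq_to_K]
      norm_cast
    have h2 : (π.real {x} : ℂ) ≠ 0 := by exact_mod_cast hp.ne'
    rw [Complex.ofReal_div, eq_div_iff h2, mul_comm, h1]
  rw [hentry, Complex.real_le_real, mul_div_assoc', div_le_div_iff₀ hV hp]
  have hsq := mul_self_le_mul_self (by positivity) hhalf
  have hs := Real.mul_self_sqrt hV.le
  calc 1 / 4 * π.real {x} * π.real {x} = π.real {x} / 2 * (π.real {x} / 2) := by ring
    _ ≤ _ := hsq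
    _ = (√(π.real (Metric.closedBall x r)) * √(π.real (Metric.closedBall x r))) * ‖g‖ ^ 2 := by ring
    _ = _ := by rw [hs, mul_comm]

end IsStochasticHermitianContraction

end

/-! ### The lower bound at an arbitrary admissible radius -/

/-- The full geometric series equals `C / (2 C) = 1 / 2`. This is the origin of `1 + 2 C` in the
condition on `v 0`: the annuli together lose at most half of the mass. -/
theorem sum_inv_pow_succ_le {C : ℝ} (hC : 0 < C) (m : ℕ) :
    ∑ i ∈ Finset.range m, C * ((1 + 2 * C)⁻¹) ^ (i + 1) ≤ 1 / 2 := by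
  have h : ∑ i ∈ Finset.range m, C * ((1 + 2 * C)⁻¹) ^ (i + 1) =
      (1 - ((1 + 2 * C)⁻¹) ^ m) / 2 := by
    induction m with
    | zero => simp
    | succ m ih =>
      rw [Finset.sum_range_succ, ih, pow_succ]
      field_simp
      ring
  rw [h]
  have : 0 < ((1 + 2 * C)⁻¹) ^ m := by positivity
  linarith

theorem half_log_le_log {C y : ℝ} (hC : 0 < C) (h : (1 + 2 * C) ^ (1 / 2 : ℝ) ≤ y) :
    1 / 2 * Real.log (1 + 2 * C) ≤ Real.log y := by
  rw [← Real.log_rpow (by positivity)]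
  exact Real.log_le_log (by positivity) h

theorem entry_one_self {X : Type*} [MeasurableSpace X] [MeasurableSingletonClass X]
    (π : Measure X) [IsPositiveOnPoints π] (x : X) :
    entry (1 : Lp ℂ 2 π →L[ℂ] Lp ℂ 2 π) x x = 1 := by
  rw [entry, one_apply_eq_self]
  exact indicatorConstLp_apply_of_mem _ _ (mem_singleton x)

/-- The lower bound on the diagonal at every admissible radius. -/
theorem exists_le_entry {k : ℕ} (hk : 1 ≤ k) {s₀ : ℝ} (hs₀ : 0 < s₀)
    (hs₀' : s₀ < (2 : ℝ) ^ (-1 + 1 / (k : ℝ))) :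
    ∃ C c : ℝ, 1 ≤ C ∧ 0 < c ∧
      ∀ (X : Type u) [MetricSpace X] [Countable X] [MeasurableSpace X] [MeasurableSingletonClass X]
        (π : Measure X) [IsPositiveOnPoints π] (M : Lp ℂ 2 π →L[ℂ] Lp ℂ 2 π),
        IsStochasticHermitianContraction s₀ M →
        ∀ (x : X) (v : ℝ → ℝ),
          (∀ t, 0 ≤ t → 0 < v t) →
          MonotoneOn v (Ici 0) →
          (∀ t, 0 ≤ t → π (Metric.closedBall x (2 * t)) ≤ π {x} * ENNReal.ofReal (v t)) →
          (1 + 2 * C) ^ (1 / 2 : ℝ) ≤ v 0 →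
          MonotoneOn (fun t => t ^ (2 * k / (2 * k - 1) : ℝ) / Real.log (v t)) (Ici 0) →
          ∀ n : ℕ, ∀ r : ℝ, 0 ≤ r → 5 * (n : ℝ) ^ (1 / (2 * k - 1) : ℝ) ≤
              c * (r ^ (2 * k / (2 * k - 1) : ℝ) / Real.log (v r)) →
            ((1 / 4 * (π.real {x} / π.real (Metric.closedBall x r)) : ℝ) : ℂ) ≤
              entry (powLaplace k M ^ (2 * n)) x x := by
  have hk0 : (1 : ℝ) ≤ k := by exact_mod_cast hk
  have hL : 0 < 2 * s₀ := by positivity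
  have hL2 : (2 * s₀) ^ k < 2 := by
    have h1 : 2 * s₀ < (2 : ℝ) ^ (1 / (k : ℝ)) := by
      rw [Real.rpow_add two_pos, Real.rpow_neg_one] at hs₀'
      linarith
    calc (2 * s₀) ^ k < ((2 : ℝ) ^ (1 / (k : ℝ))) ^ k := by
          gcongr
      _ = 2 := by
          rw [← Real.rpow_natCast, ← Real.rpow_mul two_pos.le, one_div,
            inv_mul_cancel₀ (by positivity), Real.rpow_one]
  obtain ⟨C₀, c₀, hC₀, hc₀, htail⟩ := exists_sum_chebyshev_coeff_le hk hL hL2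
  -- `C ≥ 1` gives `log (1 + 2 C) ≥ 1`, hence `log v ≥ 1/2`; together with `c ≤ 1` this turns the
  -- scale condition into `n ≤ r^(2k)`, as the tail bound requires.
  refine ⟨max C₀ 1, min c₀ 1, le_max_right _ _, lt_min hc₀ one_pos, ?_⟩
  set C := max C₀ 1 with hC
  set c := min c₀ 1 with hc
  have hC1 : 1 ≤ C := le_max_right _ _
  have hC0 : 0 < C := by linarith
  have hc0 : 0 < c := lt_min hc₀ one_pos
  intro X _ _ _ _ π _ M hM x v hvpos hvmono hvol hv0 hratio n r hr0 hr
  have hp := measureReal_singleton_pos π x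
  have hlogC : 1 ≤ Real.log (1 + 2 * C) := by
    rw [Real.le_log_iff_exp_le (by positivity)]
    linarith [Real.exp_one_lt_d9]
  have hlog : ∀ t, 0 ≤ t → 1 / 2 * Real.log (1 + 2 * C) ≤ Real.log (v t) := fun t ht =>
    half_log_le_log hC0 (hv0.trans (hvmono self_mem_Ici ht ht))
  have hfin : ∀ t, π (Metric.closedBall x t) ≠ ∞ := by
    intro t
    refine ne_top_of_le_ne_top (ENNReal.mul_ne_top (IsPositiveOnPoints.lt_top x).ne
      ENNReal.ofReal_ne_top) ((measure_mono (Metric.closedBall_subset_closedBall ?_)).trans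
        (hvol |t| (abs_nonneg t)))
    linarith [le_abs_self t, abs_nonneg t]
  rcases Nat.eq_zero_or_pos n with rfl | hn
  · rw [mul_zero, pow_zero, entry_one_self]
    have h2 : π.real {x} ≤ π.real (Metric.closedBall x r) :=
      measureReal_mono (singleton_subset_iff.2 (Metric.mem_closedBall_self hr0)) (hfin r)
    have h3 : π.real {x} / π.real (Metric.closedBall x r) ≤ 1 :=
      div_le_one_of_le₀ h2 measureReal_nonneg
    have h4 : 1 / 4 * (π.real {x} / π.real (Metric.closedBall x r)) ≤ 1 := by linarith
    exact_mod_cast h4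
  have hn0 : (0 : ℝ) < n := by exact_mod_cast hn
  set q : ℝ := 1 / (2 * k - 1) with hq
  set κ : ℝ := 2 * k / (2 * k - 1) with hκ
  have h2k : (0 : ℝ) < 2 * k - 1 := by linarith
  have hq0 : 0 < q := by positivity
  have hκq : κ = 1 + q := by rw [hκ, hq]; field_simp; ring
  have hnq : 0 < (n : ℝ) ^ q := by positivity
  have hrpos : 0 < r := by
    rcases hr0.eq_or_lt with h | h
    · rw [← h, Real.zero_rpow (by linarith)] at hr
      simp only [zero_div, mul_zero] at hr
      linarith
    · exact h
  have hlr : 0 < Real.log (v r) := lt_of_lt_of_le (by linarith) (hlog r hr0)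
  have hscale : 5 * (n : ℝ) ^ q * Real.log (v r) ≤ c * r ^ κ := by
    rwa [mul_div_assoc', le_div_iff₀ hlr] at hr
  have hnr : (n : ℝ) ≤ r ^ (2 * k) := by
    have h1 : (n : ℝ) ^ q ≤ r ^ κ := by
      have h2 : c * r ^ κ ≤ r ^ κ := mul_le_of_le_one_left (by positivity) (min_le_right _ _)
      have h3 : 1 / 2 ≤ Real.log (v r) := by linarith [hlog r hr0]
      nlinarith
    have h2 := Real.rpow_le_rpow hnq.le h1 h2k.le
    rw [← Real.rpow_mul hn0.le, ← Real.rpow_mul hr0, hq, hκ, one_div, inv_mul_cancel₀ h2k.ne',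
      div_mul_cancel₀ _ h2k.ne', Real.rpow_one] at h2
    exact_mod_cast h2
  obtain ⟨a, ha⟩ := exists_eq_sum_chebyshev (k * n) _ (natDegree_rescaledSymbol_le k (2 * s₀) n)
  refine hM.le_entry_of_concentration hk hrpos hfin fun m => ?_
  refine (norm_setIntegral_closedBall_sub_le _ hr0 hfin
    (e := fun i => C * ((1 + 2 * C)⁻¹) ^ (i + 1) * π.real {x}) (fun i => ?_) m).trans ?_
  swap
  · rw [← Finset.sum_mul]
    have := mul_le_mul_of_nonneg_right (sum_inv_pow_succ_le hC0 m) hp.le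
    linarith
  set R : ℝ := 2 ^ i * r with hR
  have h2i : (1 : ℝ) ≤ 2 ^ i := one_le_pow₀ one_le_two
  have hrR : r ≤ R := le_mul_of_one_le_left hr0 h2i
  have hR0 : 0 < R := hrpos.trans_le hrR
  have hnR : (n : ℝ) ≤ R ^ (2 * k) := hnr.trans (by gcongr)
  have hlR : 0 < Real.log (v R) := lt_of_lt_of_le (by linarith) (hlog R hR0.le)
  set Y : ℝ := c * (R * (R / n) ^ q) with hY
  have hYeq : Y = c * R ^ κ / (n : ℝ) ^ q := by
    rw [hY, Real.div_rpow hR0.le hn0.le, hκq, Real.rpow_add hR0, Real.rpow_one]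
    ring
  -- Monotonicity of the ratio carries the scale condition from `r` to the larger radius `R`. This
  -- bound absorbs the volume of the annulus; the next one, linear in `i`, makes the losses
  -- summable.
  have hY1 : 5 * Real.log (v R) ≤ Y := by
    have h1 := hratio (mem_Ici.2 hr0) (mem_Ici.2 hR0.le) hrR
    have h2 : 5 * (n : ℝ) ^ q ≤ c * (R ^ κ / Real.log (v R)) :=
      hr.trans (by gcongr)
    rw [mul_div_assoc', le_div_iff₀ hlR] at h2
    rw [hYeq, le_div_iff₀ hnq]
    linarith
  have hY2 : (i + 1) * (5 * Real.log (v r)) ≤ Y := by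
    have h1 : ((i : ℝ) + 1) * r ^ κ ≤ R ^ κ := by
      rw [hR, Real.mul_rpow (by positivity) hr0]
      gcongr
      calc (i : ℝ) + 1 ≤ 2 ^ i := by exact_mod_cast Nat.lt_two_pow_self
        _ = ((2 : ℝ) ^ i) ^ (1 : ℝ) := (Real.rpow_one _).symm
        _ ≤ ((2 : ℝ) ^ i) ^ κ := Real.rpow_le_rpow_of_exponent_le h2i (by linarith)
    rw [hYeq, le_div_iff₀ hnq]
    calc ((i : ℝ) + 1) * (5 * Real.log (v r)) * (n : ℝ) ^ q
        = (i + 1) * (5 * (n : ℝ) ^ q * Real.log (v r)) := by ring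
      _ ≤ (i + 1) * (c * r ^ κ) := by gcongr
      _ = c * ((i + 1) * r ^ κ) := by ring
      _ ≤ c * R ^ κ := by gcongr
  have hE := htail n hn a ha R hR0.le hnR
  have hannulus := hM.norm_setIntegral_aeval_le (N := k * n) (a := a)
    (q := rescaledChebyshev (2 * s₀)) (natDegree_rescaledChebyshev_le _)
    (fun j => hM.norm_aeval_le _ fun t h1 h2 => norm_eval_rescaledChebyshev_le hL j h1 h2)
    (x := x) (R := R) (A := Metric.closedBall x (2 ^ (i + 1) * r) \ Metric.closedBall x R)
    (fun y hy => by
      have := hy.2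
      rw [Metric.mem_closedBall, not_le, dist_comm] at this
      exact this)
    (ne_top_of_le_ne_top (hfin _) (measure_mono sdiff_subset))
  rw [← symbol_eq_sum hL ha, ← powLaplace_pow_eq_aeval] at hannulus
  refine hannulus.trans ?_
  have hV : π.real (Metric.closedBall x (2 ^ (i + 1) * r) \ Metric.closedBall x R) ≤
      π.real {x} * v R := by
    refine (measureReal_mono sdiff_subset (hfin _)).trans ?_
    have h1 := hvol R hR0.le
    rw [show 2 * R = 2 ^ (i + 1) * r by rw [hR, pow_succ]; ring] at h1
    have h2 := ENNReal.toReal_mono (ENNReal.mul_ne_top (IsPositiveOnPoints.lt_top x).ne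
      ENNReal.ofReal_ne_top) h1
    rwa [ENNReal.toReal_mul, ENNReal.toReal_ofReal (hvpos R hR0.le).le] at h2
  have hsqrt : √(π.real {x}) * √(π.real (Metric.closedBall x (2 ^ (i + 1) * r) \
      Metric.closedBall x R)) ≤ π.real {x} * Real.exp (Real.log (v R) / 2) := by
    rw [← Real.sqrt_mul hp.le, Real.exp_half, Real.exp_log (hvpos R hR0.le)]
    calc _ ≤ √(π.real {x} * (π.real {x} * v R)) := by gcongr
      _ = _ := by rw [← mul_assoc, Real.sqrt_mul (by positivity), Real.sqrt_mul_self hp.le]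
  have hsum : ∑ j ∈ (Finset.range (k * n + 1)).filter (fun j : ℕ => R < j), ‖a j‖ ≤
      C * Real.exp (-Y) := by
    refine hE.trans ?_
    have h1 : Y ≤ c₀ * (R * (R / n) ^ q) := by
      rw [hY]
      gcongr
      exact min_le_left _ _
    gcongr
    exact le_max_left _ _
  calc _ ≤ C * Real.exp (-Y) * (π.real {x} * Real.exp (Real.log (v R) / 2)) := by gcongr
    _ = C * Real.exp (-Y + Real.log (v R) / 2) * π.real {x} := by rw [Real.exp_add]; ring
    _ ≤ C * Real.exp ((i + 1 : ℕ) * Real.log ((1 + 2 * C)⁻¹)) * π.real {x} := by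
        gcongr
        rw [Real.log_inv]
        have h1 := hlog r hr0
        have h2 : ((i : ℝ) + 1) * (1 / 2 * Real.log (1 + 2 * C)) ≤ (i + 1) * Real.log (v r) := by
          gcongr
        have h3 : 0 ≤ ((i : ℝ) + 1) * Real.log (1 + 2 * C) := by positivity
        -- A tenth of `Y` pays for `log (v R) / 2`, and the rest is at least `(9/4) (i + 1) log (1 +
        -- 2 C)`.
        push_cast
        nlinarith
    _ = _ := by rw [Real.exp_nat_mul, Real.exp_log (by positivity)]

/-! ### Volume growth bounded by `exp (a + w t)` -/

theorem monotoneOn_rpow_div_log_exp {κ a : ℝ} (hκ : 0 < κ) (ha : 0 < a) {w : ℝ → ℝ}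
    (hw : ∀ t, 0 ≤ t → 0 ≤ w t)
    (h : ∀ s t, 0 < s → s ≤ t → s ^ κ * w t ≤ t ^ κ * w s) :
    MonotoneOn (fun t => t ^ κ / Real.log (Real.exp (a + w t))) (Ici 0) := by
  intro s hs t ht hst
  rw [mem_Ici] at hs ht
  simp only [Real.log_exp]
  have h1 := hw s hs
  have h2 := hw t ht
  rcases hs.eq_or_lt with h0 | h0
  · rw [← h0, Real.zero_rpow hκ.ne', zero_div]
    positivity
  · rw [div_le_div_iff₀ (by positivity) (by positivity)]
    have h3 := h s t h0 hst
    have h4 : s ^ κ * a ≤ t ^ κ * a := by gcongr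
    linarith

/-- The lower bound on the diagonal for volume growth bounded by `exp (a + w t)`. -/
theorem exists_exp_le_entry {k : ℕ} (hk : 1 ≤ k) {s₀ : ℝ} (hs₀ : 0 < s₀)
    (hs₀' : s₀ < (2 : ℝ) ^ (-1 + 1 / (k : ℝ))) :
    ∃ a₀ c : ℝ, 0 < a₀ ∧ 0 < c ∧ ∀ a, a₀ ≤ a →
      ∀ (X : Type u) [MetricSpace X] [Countable X] [MeasurableSpace X] [MeasurableSingletonClass X]
        (π : Measure X) [IsPositiveOnPoints π] (M : Lp ℂ 2 π →L[ℂ] Lp ℂ 2 π),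
        IsStochasticHermitianContraction s₀ M →
        ∀ (x : X) (w : ℝ → ℝ), (∀ t, 0 ≤ t → 0 ≤ w t) → MonotoneOn w (Ici 0) →
          (∀ s t, 0 < s → s ≤ t → s ^ (2 * k / (2 * k - 1) : ℝ) * w t ≤
            t ^ (2 * k / (2 * k - 1) : ℝ) * w s) →
          (∀ t, 0 ≤ t →
            π (Metric.closedBall x (2 * t)) ≤ π {x} * ENNReal.ofReal (Real.exp (a + w t))) →
          ∀ n : ℕ, ∀ r : ℝ, 0 ≤ r → 5 * (n : ℝ) ^ (1 / (2 * k - 1) : ℝ) * (a + w r) ≤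
              c * r ^ (2 * k / (2 * k - 1) : ℝ) →
            ((1 / 4 * Real.exp (-(a + w r)) : ℝ) : ℂ) ≤ entry (powLaplace k M ^ (2 * n)) x x := by
  obtain ⟨C, c, hC, hc, hmain⟩ := exists_le_entry.{u} hk hs₀ hs₀'
  have hk0 : (1 : ℝ) ≤ k := by exact_mod_cast hk
  have hκ : (0 : ℝ) < 2 * k / (2 * k - 1) := div_pos (by linarith) (by linarith)
  -- The threshold for `a` is exactly `exp a ≥ (1 + 2 C)^(1/2)`, the condition on `v 0` when `w 0 =
  -- 0`.
  refine ⟨1 / 2 * Real.log (1 + 2 * C), c, mul_pos (by norm_num) (Real.log_pos (by linarith)), hc,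
    fun a ha X _ _ _ _ π _ M hM x w hw hwm hratio hvol n r hr hnr => ?_⟩
  have ha0 : 0 < a := lt_of_lt_of_le (mul_pos (by norm_num) (Real.log_pos (by linarith))) ha
  have hpos : 0 < a + w r := add_pos_of_pos_of_nonneg ha0 (hw r hr)
  have hp := measureReal_singleton_pos π x
  have h := hmain X π M hM x (fun t => Real.exp (a + w t)) (fun _ _ => Real.exp_pos _)
    (fun s hs t ht hst => Real.exp_le_exp.2 (by linarith [hwm hs ht hst])) hvol (by
      rw [Real.rpow_def_of_pos (by linarith), mul_comm]
      exact Real.exp_le_exp.2 (by linarith [hw 0 le_rfl]))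
    (monotoneOn_rpow_div_log_exp hκ ha0 hw hratio) n r hr (by
      rwa [Real.log_exp, mul_div_assoc', le_div_iff₀ hpos])
  refine le_trans (Complex.real_le_real.2 ?_) h
  have hfin : π {x} * ENNReal.ofReal (Real.exp (a + w r)) ≠ ∞ :=
    ENNReal.mul_ne_top (IsPositiveOnPoints.lt_top x).ne ENNReal.ofReal_ne_top
  have hVle : π (Metric.closedBall x r) ≤ π {x} * ENNReal.ofReal (Real.exp (a + w r)) :=
    (measure_mono (Metric.closedBall_subset_closedBall (by linarith))).trans (hvol r hr)
  have hV : 0 < π.real (Metric.closedBall x r) :=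
    hp.trans_le (measureReal_mono (singleton_subset_iff.2 (Metric.mem_closedBall_self hr))
      (ne_top_of_le_ne_top hfin hVle))
  have hV2 := ENNReal.toReal_mono hfin hVle
  rw [ENNReal.toReal_mul, ENNReal.toReal_ofReal (Real.exp_pos _).le] at hV2
  gcongr
  rw [le_div_iff₀ hV, Real.exp_neg, ← div_eq_inv_mul, div_le_iff₀ (Real.exp_pos _)]
  exact hV2

/-! ### Polynomial and stretched exponential growth -/

/-- For `κ = 1` this is Bernoulli's inequality `1 + 2 t ≤ (1 + 2 s)^(t/s)`; the remaining power `κ -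
1 ≥ 0` is monotone. -/
theorem rpow_mul_log_le {κ s t : ℝ} (hκ : 1 ≤ κ) (hs : 0 < s) (hst : s ≤ t) :
    s ^ κ * Real.log (1 + 2 * t) ≤ t ^ κ * Real.log (1 + 2 * s) := by
  have ht : 0 < t := hs.trans_le hst
  have h1 : s * Real.log (1 + 2 * t) ≤ t * Real.log (1 + 2 * s) := by
    have h := one_add_mul_self_le_rpow_one_add (s := 2 * s) (by linarith) (p := t / s)
      ((one_le_div hs).2 hst)
    rw [show 1 + t / s * (2 * s) = 1 + 2 * t by field_simp] at h
    have h2 := Real.log_le_log (by positivity) h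
    rw [Real.log_rpow (by positivity), div_mul_eq_mul_div, le_div_iff₀ hs] at h2
    linarith
  have hsplit : ∀ u : ℝ, 0 < u → u ^ κ = u ^ (κ - 1) * u := fun u hu => by
    rw [Real.rpow_sub_one hu.ne', div_mul_cancel₀ _ hu.ne']
  have h2 : 0 ≤ Real.log (1 + 2 * s) := Real.log_nonneg (by linarith)
  rw [hsplit s hs, hsplit t ht, mul_assoc, mul_assoc]
  have h3 : s ^ (κ - 1) ≤ t ^ (κ - 1) := Real.rpow_le_rpow hs.le hst (by linarith)
  exact mul_le_mul h3 h1 (mul_nonneg hs.le (Real.log_nonneg (by linarith))) (by positivity)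

theorem rpow_mul_rpow_le {κ β s t : ℝ} (hβ : β ≤ κ) (hs : 0 < s) (hst : s ≤ t) :
    s ^ κ * (2 * t) ^ β ≤ t ^ κ * (2 * s) ^ β := by
  have ht : 0 < t := hs.trans_le hst
  have hsplit : ∀ u : ℝ, 0 < u → u ^ κ = u ^ (κ - β) * u ^ β := fun u hu => by
    rw [← Real.rpow_add hu, sub_add_cancel]
  have h3 : s ^ (κ - β) ≤ t ^ (κ - β) := Real.rpow_le_rpow hs.le hst (by linarith)
  rw [hsplit s hs, hsplit t ht, Real.mul_rpow two_pos.le ht.le, Real.mul_rpow two_pos.le hs.le]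
  calc s ^ (κ - β) * s ^ β * (2 ^ β * t ^ β) = s ^ (κ - β) * (s ^ β * 2 ^ β * t ^ β) := by ring
    _ ≤ t ^ (κ - β) * (s ^ β * 2 ^ β * t ^ β) := by gcongr
    _ = _ := by ring

/-- A radius `B S` at which the condition of `exists_exp_le_entry` holds for polynomial growth. -/
theorem exists_radius_of_log_growth {a D c : ℝ} (ha0 : 0 < a) (hD : 0 ≤ D) (hc : 0 < c) :
    ∃ B : ℝ, 1 ≤ B ∧ ∀ κ S P Q N : ℝ, 1 ≤ κ → 0 < S → S ≤ N → 1 / 2 ≤ Real.log N → 0 ≤ P → P ≤ Q →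
      S ^ κ = Q * Real.log N →
      5 * P * (a + D * Real.log (1 + 2 * (B * S))) ≤ c * (B * S) ^ κ := by
  set K : ℝ := 5 * (2 * a + 9 * D) with hK
  set b : ℝ := max 1 (K / c) with hb
  have hb1 : 1 ≤ b := le_max_left _ _
  have hbK : K ≤ c * b := by
    have : K / c ≤ b := le_max_right _ _
    rwa [div_le_iff₀' hc] at this
  -- A square, because `log (1 + 2 B)` then grows at most linearly in `b` while `c B` is quadratic
  -- and wins as soon as `c b ≥ K`.
  set B : ℝ := b ^ 2 with hB
  have hB1 : 1 ≤ B := one_le_pow₀ hb1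
  have hlogB : Real.log (1 + 2 * B) ≤ 4 * b := by
    calc Real.log (1 + 2 * B) ≤ Real.log ((2 * b) ^ 2) :=
          Real.log_le_log (by positivity) (by nlinarith)
      _ = 2 * Real.log (2 * b) := by rw [Real.log_pow]; norm_num
      _ ≤ 2 * (2 * b) := by
          have := Real.log_le_self (by positivity : (0 : ℝ) ≤ 2 * b)
          linarith
      _ = 4 * b := by ring
  refine ⟨B, hB1, fun κ S P Q N hκ hS0 hSN hl2 hP hPQ hSκ => ?_⟩
  set l : ℝ := Real.log N with hl
  have hl0 : 0 < l := by linarith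
  have hN0 : 0 < N := hS0.trans_le hSN
  have hN1 : 1 ≤ N := by
    by_contra hcon
    exact absurd (Real.log_nonpos hN0.le (not_le.1 hcon).le) (not_le.2 hl0)
  have hlogr : Real.log (1 + 2 * (B * S)) ≤ 4 * b + l := by
    calc Real.log (1 + 2 * (B * S)) ≤ Real.log ((1 + 2 * B) * N) := by
          refine Real.log_le_log (by positivity) ?_
          nlinarith
      _ = Real.log (1 + 2 * B) + l := Real.log_mul (by positivity) (by positivity)
      _ ≤ _ := by linarith
  rw [Real.mul_rpow (by positivity) hS0.le, hSκ]
  have hBκ : B ≤ B ^ κ := Real.self_le_rpow_of_one_le hB1 hκ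
  have h1 : 5 * (a + D * Real.log (1 + 2 * (B * S))) ≤ c * B * l := by
    calc 5 * (a + D * Real.log (1 + 2 * (B * S))) ≤ 5 * (a + D * (4 * b + l)) := by gcongr
      _ ≤ K * b * l := by
          have h2 : a ≤ a * (2 * b * l) := le_mul_of_one_le_right ha0.le (by nlinarith)
          have h3 : 4 * b + l ≤ 9 * b * l := by nlinarith
          have h4 : D * (4 * b + l) ≤ D * (9 * b * l) := by gcongr
          rw [hK]
          linarith
      _ ≤ c * b * b * l := by gcongr
      _ = c * B * l := by rw [hB]; ring
  calc 5 * P * (a + D * Real.log (1 + 2 * (B * S)))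
      = P * (5 * (a + D * Real.log (1 + 2 * (B * S)))) := by ring
    _ ≤ P * (c * B * l) := by gcongr
    _ ≤ Q * (c * B * l) := by gcongr
    _ ≤ Q * (c * B ^ κ * l) := by
        have := hP.trans hPQ
        gcongr
    _ = _ := by ring

/-- The scale `((1 + n) log (1 + n) ^ (2k - 1)) ^ (1 / 2k)`. -/
theorem logScale_bounds {κ₀ m l : ℝ} (hκ₀ : 1 < κ₀) (hl2 : 1 / 2 ≤ l) (hm : 1 ≤ m) (hlm : l ≤ m) :
    let S := (m * l ^ (κ₀ - 1)) ^ (1 / κ₀)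
    1 / 2 ≤ S ∧ S ≤ m ∧ S ^ (κ₀ / (κ₀ - 1)) = m ^ (1 / (κ₀ - 1)) * l := by
  intro S
  have hl0 : 0 < l := by linarith
  have hκ1 : 0 < κ₀ - 1 := by linarith
  have hκ0 : 0 < κ₀ := by linarith
  have hbase : 0 < m * l ^ (κ₀ - 1) := by positivity
  -- Used with `u = 1/2` and `u = m`, the lower and upper bounds for both `l` and `m`.
  have hroot : ∀ u : ℝ, 0 < u → (u * u ^ (κ₀ - 1)) ^ (1 / κ₀) = u := by
    intro u hu
    rw [mul_comm, ← Real.rpow_add_one hu.ne', ← Real.rpow_mul hu.le, sub_add_cancel,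
      mul_one_div_cancel hκ0.ne', Real.rpow_one]
  refine ⟨?_, ?_, ?_⟩
  · calc (1 / 2 : ℝ) = ((1 / 2) * (1 / 2) ^ (κ₀ - 1)) ^ (1 / κ₀) :=
          (hroot _ (by positivity)).symm
      _ ≤ S := by
          refine Real.rpow_le_rpow (by positivity) ?_ (by positivity)
          gcongr
          linarith
  · calc S ≤ (m * m ^ (κ₀ - 1)) ^ (1 / κ₀) := by
          refine Real.rpow_le_rpow (by positivity) ?_ (by positivity)
          gcongr
      _ = _ := hroot _ (by positivity)
  · rw [← Real.rpow_mul hbase.le, show 1 / κ₀ * (κ₀ / (κ₀ - 1)) = 1 / (κ₀ - 1) by field_simp,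
      Real.mul_rpow (by positivity) (by positivity), ← Real.rpow_mul hl0.le,
      mul_one_div_cancel hκ1.ne', Real.rpow_one]

/-- The bound would tend to zero while every ball contains its centre, so polynomial growth with `D
< 0` is vacuous. -/
theorem not_forall_le_of_neg_growth {X : Type*} [MetricSpace X] [MeasurableSpace X]
    {π : Measure X} [IsPositiveOnPoints π] {A D : ℝ} (hD : D < 0) (x : X) :
    ¬ ∀ t, 0 ≤ t → π (Metric.closedBall x t) ≤ π {x} * ENNReal.ofReal (A * (1 + t) ^ D) := by
  intro hvol
  have hlim : Tendsto (fun t : ℝ => A * (1 + t) ^ D) atTop (nhds 0) := by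
    have h1 := (tendsto_rpow_neg_atTop (neg_pos.2 hD)).comp (tendsto_atTop_add_const_left atTop 1
      tendsto_id)
    simpa [Function.comp_def] using h1.const_mul A
  obtain ⟨t, ht1, ht0⟩ := ((hlim.eventually (gt_mem_nhds one_pos)).and
    (eventually_ge_atTop 0)).exists
  have h1 : π {x} ≤ π {x} * ENNReal.ofReal (A * (1 + t) ^ D) :=
    (measure_mono (singleton_subset_iff.2 (Metric.mem_closedBall_self ht0))).trans (hvol t ht0)
  have h2 : π {x} * ENNReal.ofReal (A * (1 + t) ^ D) < π {x} * 1 :=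
    (ENNReal.mul_lt_mul_iff_right (IsPositiveOnPoints.pos x).ne'
      (IsPositiveOnPoints.lt_top x).ne).2 (ENNReal.ofReal_lt_one.2 ht1)
  rw [mul_one] at h2
  exact absurd h1 (not_le.2 h2)

/-- Polynomial volume growth. -/
theorem exists_le_entry_of_polynomial_growth {k : ℕ} (hk : 1 ≤ k) {s₀ : ℝ} (hs₀ : 0 < s₀)
    (hs₀' : s₀ < (2 : ℝ) ^ (-1 + 1 / (k : ℝ))) (A D : ℝ) : ∃ a : ℝ, 0 < a ∧
      ∀ (X : Type u) [MetricSpace X] [Countable X] [MeasurableSpace X] [MeasurableSingletonClass X]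
        (π : Measure X) [IsPositiveOnPoints π] (M : Lp ℂ 2 π →L[ℂ] Lp ℂ 2 π),
        IsStochasticHermitianContraction s₀ M →
        ∀ x : X,
          (∀ t, 0 ≤ t →
            π (Metric.closedBall x t) ≤ π {x} * ENNReal.ofReal (A * (1 + t) ^ D)) →
          ∀ n : ℕ, 1 ≤ n →
            ((a * ((1 + n : ℝ) * Real.log (1 + n) ^ (2 * k - 1 : ℝ)) ^ (-D / (2 * k)) : ℝ) : ℂ) ≤
              entry (powLaplace k M ^ (2 * n)) x x := by
  rcases lt_or_ge D 0 with hD | hD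
  · exact ⟨1, one_pos, fun X _ _ _ _ π _ M hM x hvol => absurd hvol
      (not_forall_le_of_neg_growth hD x)⟩
  obtain ⟨a₀, c, ha₀, hc, hmain⟩ := exists_exp_le_entry.{u} hk hs₀ hs₀'
  have hk0 : (1 : ℝ) ≤ k := by exact_mod_cast hk
  have h2k : (0 : ℝ) < 2 * k - 1 := by linarith
  have hκ1 : (1 : ℝ) ≤ 2 * k / (2 * k - 1) := by
    rw [one_le_div h2k]
    linarith
  -- Adding `|A|` lets `exp (a₀ + |A|)` dominate the prefactor `A`.
  have ha0 : 0 < a₀ + |A| := by positivity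
  obtain ⟨B, hB1, hB⟩ := exists_radius_of_log_growth ha0 hD hc
  -- The factor `2 + 2 B` comes from `1 + 2 B S ≤ (2 + 2 B) S`, valid since `S ≥ 1/2`.
  refine ⟨1 / 4 * Real.exp (-(a₀ + |A|)) * (2 + 2 * B) ^ (-D), by positivity,
    fun X _ _ _ _ π _ M hM x hvol n hn => ?_⟩
  have hn1 : (1 : ℝ) ≤ n := by exact_mod_cast hn
  have hl2 : 1 / 2 ≤ Real.log (1 + n) := by
    have h1 : Real.log 2 ≤ Real.log (1 + n) := Real.log_le_log two_pos (by linarith)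
    linarith [Real.log_two_gt_d9]
  have hl0 : 0 < Real.log (1 + n) := by linarith
  have hln : Real.log (1 + n) ≤ 1 + n := Real.log_le_self (by linarith)
  obtain ⟨hSge, hSle, hSκ⟩ := logScale_bounds (κ₀ := 2 * k) (by linarith) hl2
    (by linarith : (1 : ℝ) ≤ 1 + n) hln
  set S : ℝ := ((1 + n : ℝ) * Real.log (1 + n) ^ (2 * k - 1 : ℝ)) ^ (1 / (2 * k) : ℝ) with hS
  have hS0 : 0 < S := by linarith
  have h := hmain (a₀ + |A|) (by linarith [abs_nonneg A]) X π M hM x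
    (fun t => D * Real.log (1 + 2 * t))
    (fun t ht => mul_nonneg hD (Real.log_nonneg (by linarith)))
    (fun s hs t ht hst => by
      rw [mem_Ici] at hs ht
      have : Real.log (1 + 2 * s) ≤ Real.log (1 + 2 * t) :=
        Real.log_le_log (by positivity) (by linarith)
      exact mul_le_mul_of_nonneg_left this hD)
    (fun s t hs hst => by
      rw [mul_left_comm, mul_left_comm (t ^ _)]
      exact mul_le_mul_of_nonneg_left (rpow_mul_log_le hκ1 hs hst) hD)
    (fun t ht => (hvol (2 * t) (by positivity)).trans (by
      gcongr
      rw [Real.exp_add, mul_comm D, ← Real.rpow_def_of_pos (by positivity)]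
      gcongr
      have := Real.add_one_le_exp (a₀ + |A|)
      linarith [le_abs_self A]))
    n (B * S) (by positivity)
    (hB _ S _ _ (1 + n) hκ1 hS0 hSle hl2 (by positivity)
      (Real.rpow_le_rpow (by positivity) (by linarith) (by positivity)) hSκ)
  refine le_trans (Complex.real_le_real.2 ?_) h
  have hexp : Real.exp (-(a₀ + |A| + D * Real.log (1 + 2 * (B * S)))) =
      Real.exp (-(a₀ + |A|)) * (1 + 2 * (B * S)) ^ (-D) := by
    rw [Real.rpow_def_of_pos (by positivity), ← Real.exp_add]
    ring_nf
  have hSD : ((1 + n : ℝ) * Real.log (1 + n) ^ (2 * k - 1 : ℝ)) ^ (-D / (2 * k)) = S ^ (-D) := by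
    rw [hS, ← Real.rpow_mul (by positivity)]
    ring_nf
  rw [hexp, hSD, mul_assoc, mul_assoc, ← Real.mul_rpow (by positivity) hS0.le]
  refine mul_le_mul_of_nonneg_left (mul_le_mul_of_nonneg_left ?_ (Real.exp_pos _).le) (by norm_num)
  exact Real.rpow_le_rpow_of_nonpos (by positivity) (by linarith) (by linarith)

/-- Stretched exponential volume growth. -/
theorem exists_le_entry_of_exponential_growth {k : ℕ} (hk : 1 ≤ k) {s₀ : ℝ} (hs₀ : 0 < s₀)
    (hs₀' : s₀ < (2 : ℝ) ^ (-1 + 1 / (k : ℝ))) (A β : ℝ) (hβ : 0 < β)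
    (hβ' : β < 2 * k / (2 * k - 1)) : ∃ A₀ : ℝ, 0 < A₀ ∧
      ∀ (X : Type u) [MetricSpace X] [Countable X] [MeasurableSpace X] [MeasurableSingletonClass X]
        (π : Measure X) [IsPositiveOnPoints π] (M : Lp ℂ 2 π →L[ℂ] Lp ℂ 2 π),
        IsStochasticHermitianContraction s₀ M →
        ∀ x : X,
          (∀ t, 0 ≤ t →
            π (Metric.closedBall x t) ≤ π {x} * ENNReal.ofReal (Real.exp (A * t ^ β))) →
          ∀ n : ℕ,
            ((Real.exp (-A₀ * (n : ℝ) ^ (β * (2 * k - 1) / (2 * k * (1 - β) + β))) : ℝ) : ℂ) ≤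
              entry (powLaplace k M ^ (2 * n)) x x := by
  obtain ⟨a, c, ha, hc, hmain⟩ := exists_exp_le_entry.{u} hk hs₀ hs₀'
  have hk0 : (1 : ℝ) ≤ k := by exact_mod_cast hk
  have h2k : (0 : ℝ) < 2 * k - 1 := by linarith
  set q : ℝ := 1 / (2 * k - 1) with hq
  set κ : ℝ := 2 * k / (2 * k - 1) with hκ
  have hden : 0 < 2 * k * (1 - β) + β := by
    rw [hκ, lt_div_iff₀ h2k] at hβ'
    linarith
  set γ : ℝ := 1 / (2 * k * (1 - β) + β) with hγ
  have hγ0 : 0 < γ := by positivity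
  have hκβ : 0 < κ - β := by linarith
  have hγq : γ * (κ - β) = q := by
    have : κ - β = (2 * k * (1 - β) + β) * q := by
      rw [hκ, hq]
      field_simp
      ring
    rw [this, hγ, ← mul_assoc, one_div_mul_cancel hden.ne', one_mul]
  set A' : ℝ := |A| * 2 ^ β with hA'
  have hA'0 : 0 ≤ A' := by positivity
  set B : ℝ := max 1 ((5 * (a + A') / c) ^ (1 / (κ - β))) with hB
  have hB1 : 1 ≤ B := le_max_left _ _
  have hBpow : 5 * (a + A') ≤ c * B ^ (κ - β) := by
    rw [← div_le_iff₀' hc]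
    calc 5 * (a + A') / c = ((5 * (a + A') / c) ^ (1 / (κ - β))) ^ (κ - β) := by
          rw [← Real.rpow_mul (by positivity), one_div_mul_cancel hκβ.ne', Real.rpow_one]
      _ ≤ _ := by
          gcongr
          exact le_max_right _ _
  -- The summand `2` absorbs the factor `1/4 ≥ exp (-2)`. For `n ≥ 1` the power of `n` in the
  -- exponent is at least `1`, so additive constants can be absorbed; `n = 0` is separate.
  refine ⟨2 + a + A' * B ^ β, by positivity, fun X _ _ _ _ π _ M hM x hvol n => ?_⟩
  have hδ0 : 0 < β * (2 * k - 1) / (2 * k * (1 - β) + β) := by positivity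
  rcases Nat.eq_zero_or_pos n with rfl | hn
  · rw [mul_zero, pow_zero, entry_one_self, Nat.cast_zero, Real.zero_rpow hδ0.ne', mul_zero,
      Real.exp_zero, Complex.ofReal_one]
  have hn1 : (1 : ℝ) ≤ n := by exact_mod_cast hn
  set r : ℝ := B * (n : ℝ) ^ γ with hr
  have hr1 : 1 ≤ r := one_le_mul_of_one_le_of_one_le hB1 (Real.one_le_rpow hn1 hγ0.le)
  have hr0 : 0 < r := by linarith
  have h2r : |A| * (2 * r) ^ β = A' * r ^ β := by
    rw [Real.mul_rpow two_pos.le hr0.le, hA', mul_assoc]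
  have h := hmain a le_rfl X π M hM x (fun t => |A| * (2 * t) ^ β)
    (fun t ht => by positivity)
    (fun s hs t ht hst => by
      rw [mem_Ici] at hs ht
      dsimp only
      gcongr)
    (fun s t hs hst => by
      have := rpow_mul_rpow_le hβ'.le hs hst
      calc s ^ κ * (|A| * (2 * t) ^ β) = |A| * (s ^ κ * (2 * t) ^ β) := by ring
        _ ≤ |A| * (t ^ κ * (2 * s) ^ β) := by gcongr
        _ = _ := by ring)
    (fun t ht => (hvol (2 * t) (by positivity)).trans (by
      gcongr
      have : A * (2 * t) ^ β ≤ |A| * (2 * t) ^ β := by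
        gcongr
        exact le_abs_self A
      linarith))
    n r hr0.le (by
      rw [h2r]
      have hrβ : 1 ≤ r ^ β := Real.one_le_rpow hr1 hβ.le
      have hrκ : r ^ κ = r ^ β * (B ^ (κ - β) * (n : ℝ) ^ q) := by
        rw [← hγq, Real.rpow_mul (by positivity), ← Real.mul_rpow (by positivity) (by positivity),
          ← hr, ← Real.rpow_add hr0]
        ring_nf
      calc 5 * (n : ℝ) ^ q * (a + A' * r ^ β)
          ≤ 5 * (n : ℝ) ^ q * (a * r ^ β + A' * r ^ β) := by
            gcongr
            exact le_mul_of_one_le_right ha.le hrβ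
        _ = 5 * (a + A') * (r ^ β * (n : ℝ) ^ q) := by ring
        _ ≤ c * B ^ (κ - β) * (r ^ β * (n : ℝ) ^ q) := by gcongr
        _ = _ := by rw [hrκ]; ring)
  rw [h2r] at h
  refine le_trans (Complex.real_le_real.2 ?_) h
  set d : ℝ := (n : ℝ) ^ (β * (2 * k - 1) / (2 * k * (1 - β) + β)) with hd
  have hd1 : 1 ≤ d := Real.one_le_rpow hn1 hδ0.le
  -- The radius yields the exponent `γ β`; the one in `d` is `2 k - 1 ≥ 1` times larger, which is
  -- harmless because `n ≥ 1`.
  have hrd : r ^ β ≤ B ^ β * d := by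
    rw [hr, Real.mul_rpow (by positivity) (by positivity), ← Real.rpow_mul (by positivity)]
    gcongr
    refine Real.rpow_le_rpow_of_exponent_le hn1 ?_
    rw [hγ, one_div_mul_eq_div]
    gcongr
    exact le_mul_of_one_le_right hβ.le (by linarith)
  have h4 : Real.exp (-2) ≤ 1 / 4 := by
    rw [Real.exp_neg, ← one_div]
    refine one_div_le_one_div_of_le (by norm_num) ?_
    have h1 := Real.exp_one_gt_d9
    have h2 : Real.exp 2 = Real.exp 1 * Real.exp 1 := by rw [← Real.exp_add]; norm_num
    nlinarith
  calc Real.exp (-(2 + a + A' * B ^ β) * d) ≤ Real.exp (-2 + -(a + A' * r ^ β)) := by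
        refine Real.exp_le_exp.2 ?_
        have h1 : A' * r ^ β ≤ A' * (B ^ β * d) := by gcongr
        have h2 : a ≤ a * d := le_mul_of_one_le_right ha.le hd1
        linarith
    _ = Real.exp (-2) * Real.exp (-(a + A' * r ^ β)) := Real.exp_add _ _
    _ ≤ _ := by gcongr

/-! ### The theorem -/

theorem mainTheorem9 (k : ℕ) (hk : 1 ≤ k) (s₀ : ℝ) (hs₀ : 0 < s₀)
    (hs₀' : s₀ < (2 : ℝ) ^ (-1 + 1 / (k : ℝ))) :
    (∃ C c : ℝ, 0 < C ∧ 0 < c ∧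
      ∀ (X : Type u) [MetricSpace X] [Countable X] [MeasurableSpace X] [MeasurableSingletonClass X]
        (π : Measure X) [IsPositiveOnPoints π] (M : Lp ℂ 2 π →L[ℂ] Lp ℂ 2 π),
        IsStochasticHermitianContraction s₀ M →
        ∀ (x : X) (v : ℝ → ℝ),
          (∀ t, 0 ≤ t → 0 < v t) →
          MonotoneOn v (Ici 0) →
          (∀ t, 0 ≤ t → π (Metric.closedBall x (2 * t)) ≤ π {x} * ENNReal.ofReal (v t)) →
          (1 + 2 * C) ^ (1 / 2 : ℝ) ≤ v 0 →
          MonotoneOn (fun t => t ^ (2 * k / (2 * k - 1) : ℝ) / Real.log (v t)) (Ici 0) →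
          Tendsto (fun t => t ^ (2 * k / (2 * k - 1) : ℝ) / Real.log (v t)) atTop atTop →
          ∀ n : ℕ, ∃ r : ℕ,
            IsLeast {r : ℕ | 5 * (n : ℝ) ^ (1 / (2 * k - 1) : ℝ) ≤
              c * ((r : ℝ) ^ (2 * k / (2 * k - 1) : ℝ) / Real.log (v r))} r ∧
            ((1 / 4 * (π.real {x} / π.real (Metric.closedBall x r)) : ℝ) : ℂ) ≤
              entry (powLaplace k M ^ (2 * n)) x x) ∧
    (∀ A D : ℝ, ∃ a : ℝ, 0 < a ∧
      ∀ (X : Type u) [MetricSpace X] [Countable X] [MeasurableSpace X] [MeasurableSingletonClass X]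
        (π : Measure X) [IsPositiveOnPoints π] (M : Lp ℂ 2 π →L[ℂ] Lp ℂ 2 π),
        IsStochasticHermitianContraction s₀ M →
        ∀ x : X,
          (∀ t, 0 ≤ t →
            π (Metric.closedBall x t) ≤ π {x} * ENNReal.ofReal (A * (1 + t) ^ D)) →
          ∀ n : ℕ, 1 ≤ n →
            ((a * ((1 + n : ℝ) * Real.log (1 + n) ^ (2 * k - 1 : ℝ)) ^ (-D / (2 * k)) : ℝ) : ℂ) ≤
              entry (powLaplace k M ^ (2 * n)) x x) ∧
    (∀ A β : ℝ, 0 < β → β < 2 * k / (2 * k - 1) → ∃ A₀ : ℝ, 0 < A₀ ∧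
      ∀ (X : Type u) [MetricSpace X] [Countable X] [MeasurableSpace X] [MeasurableSingletonClass X]
        (π : Measure X) [IsPositiveOnPoints π] (M : Lp ℂ 2 π →L[ℂ] Lp ℂ 2 π),
        IsStochasticHermitianContraction s₀ M →
        ∀ x : X,
          (∀ t, 0 ≤ t →
            π (Metric.closedBall x t) ≤ π {x} * ENNReal.ofReal (Real.exp (A * t ^ β))) →
          ∀ n : ℕ,
            ((Real.exp (-A₀ * (n : ℝ) ^ (β * (2 * k - 1) / (2 * k * (1 - β) + β))) : ℝ) : ℂ) ≤
              entry (powLaplace k M ^ (2 * n)) x x) := by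
  refine ⟨?_, exists_le_entry_of_polynomial_growth hk hs₀ hs₀',
    exists_le_entry_of_exponential_growth hk hs₀ hs₀'⟩
  obtain ⟨C, c, hC, hc, hmain⟩ := exists_le_entry.{u} hk hs₀ hs₀'
  refine ⟨C, c, by linarith, hc,
    fun X _ _ _ _ π _ M hM x v hvpos hvmono hvol hv0 hratio hlim n => ?_⟩
  classical
  -- Divergence of the ratio gives an admissible integer radius; the least one is then just one of
  -- the radii covered by `hmain`.
  have hex : ∃ r : ℕ, 5 * (n : ℝ) ^ (1 / (2 * k - 1) : ℝ) ≤
      c * ((r : ℝ) ^ (2 * k / (2 * k - 1) : ℝ) / Real.log (v r)) :=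
    (((hlim.comp tendsto_natCast_atTop_atTop).const_mul_atTop hc).eventually_ge_atTop _).exists
  exact ⟨Nat.find hex, ⟨Nat.find_spec hex, fun _ h => Nat.find_min' hex h⟩,
    hmain X π M hM x v hvpos hvmono hvol hv0 hratio n _ (Nat.cast_nonneg _) (Nat.find_spec hex)⟩
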